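/- **Setting.** Let $R$ be a commutative ring, $I_R$ a minimal injective cogenerator of $\mathrm{Mod}\,R$, and $D=\mathrm{Hom}_R(-,I_R)$; an $R$-module $M$ is *reflexive* if the canonical map $M\to D^2M$ is bijective. Let $\mathcal A$ be a triangulated $R$-category with translation $[1]$, and let $\mathcal C$ be a *tri-exact $R$-category*, that is, a full extension-closed subcategory of $\mathcal A$ (containing $0$ and closed under isomorphisms): for every exact triangle $X\to Y\to Z\to X[1]$ in $\mathcal A$ with $X,Z\in\mathcal C$, also $Y\in\mathcal C$. Call $\mathcal C$ *right triangulated* if $X,Y\in\mathcal C$ implies $Z\in\mathcal C$ for all such triangles, *left triangulated* if $Y,Z\in\mathcal C$ implies $X\in\mathcal C$, and *triangulated* if it is both. Let $\mathcal C[n]$ be the full subcategory of the objects $X$ of $\mathcal A$ with $X[-n]\in\mathcal C$. Put $\mathrm{Ext}^1_{\mathcal C}(X,Y)=\mathrm{Hom}_{\mathcal A}(X,Y[1])$. A morphism $f$ in $\mathcal C$ is *projectively trivial* if $\mathrm{Ext}^1_{\mathcal C}(f,M)=0$ for all $M\in\mathcal C$, and *injectively trivial* if $\mathrm{Ext}^1_{\mathcal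 C}(M,f)=0$ for all $M\in\mathcal C$. Let $\underline{\mathcal C}$ (respectively, $\overline{\mathcal C}$) be the quotient of $\mathcal C$ by the ideal of projectively (respectively, injectively) trivial morphisms, with morphism modules $\underline{\mathrm{Hom}}_{\mathcal C}$ (respectively, $\overline{\mathrm{Hom}}_{\mathcal C}$). An object is *Ext-projective* (respectively, *Ext-injective*) if its identity is projectively (respectively, injectively) trivial, and *strongly indecomposable* if its endomorphism ring is local. $\mathcal C$ is *Krull–Schmidt* if every non-zero object is a finite direct sum of strongly indecomposable objects of $\mathcal C$, and *Hom-reflexive* if $\mathrm{Hom}_{\mathcal C}(X,Y)$ is a reflexive $R$-module for all $X,Y\in\mathcal C$. A morphism $f:X\to Y$ is *minimal left almost split* if every $h:Y\to Y$ with $hf=f$ is an automorphism, $f$ is not a section, and every $X\to M$ in $\mathcal C$ that is not a section factors through $f$; *minimal right almost split* is defined dually. An *almost split sequence* in $\mathcal C$ is a sequence $X\xrightarrow{f}Y\xrightarrow{g}Z$ in $\mathcal C$ that embeds in an exact triangle $X\to Y\to Z\to X[1]$ of $\mathcal A$, with $f$ minimal left almost split and $g$ minimal right almost split in $\mathcal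 C$. $\mathcal C$ *has almost split sequences on the right* (respectively, *on the left*) if every strongly indecomposable object that is not Ext-projective (respectively, not Ext-injective) is the ending term $Z$ (respectively, the starting term $X$) of an almost split sequence, and *has almost split sequences* if both hold. All functors are additive. A *right Auslander–Reiten functor* is a functor $\tau:\underline{\mathcal C}\to\overline{\mathcal C}$ with binatural $R$-linear isomorphisms $\underline{\mathrm{Hom}}_{\mathcal C}(X,Y)\to D\,\mathrm{Ext}^1_{\mathcal C}(Y,\tau X)$; a *left Auslander–Reiten functor* is a functor $\tau^-:\overline{\mathcal C}\to\underline{\mathcal C}$ with binatural $R$-linear isomorphisms $\overline{\mathrm{Hom}}_{\mathcal C}(X,Y)\to D\,\mathrm{Ext}^1_{\mathcal C}(\tau^-Y,X)$; a *right Serre functor* is a functor $\mathbb S:\underline{\mathcal C}\to\overline{\mathcal C}$ with binatural $R$-linear isomorphisms $\underline{\mathrm{Hom}}_{\mathcal C}(X,Y)\to D\,\overline{\mathrm{Hom}}_{\mathcal C}(Y,\mathbb SX)$; a *left Serre functor* is a functor $\mathbb S:\overline{\mathcal C}\to\underline{\mathcal C}$ with binatural $R$-linear isomorphisms $\overline{\mathrm{Hom}}_{\mathcal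 C}(X,Y)\to D\,\underline{\mathrm{Hom}}_{\mathcal C}(\mathbb SY,X)$; here $X,Y\in\mathcal C$. Such a functor is called an Auslander–Reiten (respectively, Serre) *equivalence* if it is an equivalence of categories. **Theorem.** Let $\mathcal C$ be a Hom-reflexive Krull–Schmidt tri-exact $R$-category. 1. If $\mathcal C$ is right triangulated, the following are equivalent: (a) $\mathcal C$ has almost split sequences on the right; (b) $\mathcal C$ admits a right Auslander–Reiten functor; (c) $\mathcal C$ admits a right Serre functor whose image lies in $\mathcal C[1]$. 2. If $\mathcal C$ is left triangulated, the following are equivalent: (a) $\mathcal C$ has almost split sequences on the left; (b) $\mathcal C$ admits a left Auslander–Reiten functor; (c) $\mathcal C$ admits a left Serre functor whose image lies in $\mathcal C[-1]$. 3. If $\mathcal C$ is triangulated, the following are equivalent: (a) $\mathcal C$ has almost split sequences; (b) $\mathcal C$ admits a right Auslander–Reiten equivalence; (c) $\mathcal C$ admits a left Auslander–Reiten equivalence; (d) $\mathcal C$ admits a right Serre equivalence; (e) $\mathcal C$ admits a left Serre equivalence. -/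

import Mathlib

open CategoryTheory
universe u v w

/-- `I` is an injective cogenerator of the category of `R`-modules. -/
def IsInjectiveCogenerator (R : Type u) [CommRing R] (I : Type u) [AddCommGroup I] [Module R I] :
    Prop :=
  Module.Injective R I ∧
    ∀ (M : Type u) [AddCommGroup M] [Module R M] (x : M), x ≠ 0 → ∃ f : M →ₗ[R] I, f x ≠ 0

/-- `I` is a minimal injective cogenerator: it is an injective cogenerator that embeds into (hence
is a direct summand of) every injective cogenerator. -/
def IsMinimalInjectiveCogenerator (R : Type u) [CommRing R] (I : Type u) [AddCommGroup I]
    [Module R I] : Prop :=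
  IsInjectiveCogenerator R I ∧
    ∀ (J : Type u) [AddCommGroup J] [Module R J], IsInjectiveCogenerator R J →
      ∃ f : I →ₗ[R] J, Function.Injective f

/-- There is a submodule containing `K₀` that is maximal among those disjoint from `T`. -/
theorem exists_maximal_disjoint {R : Type u} [CommRing R] {J : Type u} [AddCommGroup J] [Module R J]
    (T K₀ : Submodule R J) (h₀ : Disjoint T K₀) :
    ∃ K : Submodule R J, K₀ ≤ K ∧ Disjoint T K ∧
      ∀ K' : Submodule R J, Disjoint T K' → K ≤ K' → K' ≤ K := by
  obtain ⟨K, hK, hm⟩ := zorn_le_nonempty₀ {K : Submodule R J | Disjoint T K}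
    (fun c hc hch y hy => ⟨sSup c, by
      have := hch.directedOn
      exact (DirectedOn.disjoint_sSup_right this).2 (fun b hb => hc hb),
      fun z hz => le_sSup hz⟩) K₀ h₀
  exact ⟨K, hK, hm.prop, fun K' h1 h2 => hm.le_of_ge h1 h2⟩

/-- Injective envelopes exist. -/
theorem exists_injective_envelope {R : Type u} [CommRing R] (M : Type u) [AddCommGroup M]
    [Module R M] :
    ∃ (S : ModuleCat.{u} R) (i : M →ₗ[R] S), Module.Injective R S ∧ Function.Injective i ∧
      ∀ N : Submodule R S, Disjoint (LinearMap.range i) N → N = ⊥ := by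
  let E : ModuleCat.{u} R := Injective.under (ModuleCat.of R M)
  have hE : Module.Injective R E := by
    have : Injective (ModuleCat.of R E) :=
      Injective.injective_under (ModuleCat.of R M)
    exact Module.injective_module_of_injective_object R E
  let j : M →ₗ[R] E := (Injective.ι (ModuleCat.of R M)).hom
  have hj : Function.Injective j := (ModuleCat.mono_iff_injective _).1 inferInstance
  obtain ⟨K, -, hK, hKm⟩ := exists_maximal_disjoint (LinearMap.range j) ⊥ disjoint_bot_right
  obtain ⟨S, hMS, hS, hSm⟩ := exists_maximal_disjoint K (LinearMap.range j) hK.symm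
  -- the projection of `S` to `E ⧸ K`
  let p : S →ₗ[R] E ⧸ K := K.mkQ ∘ₗ S.subtype
  have hp : Function.Injective p := by
    rw [← LinearMap.ker_eq_bot, eq_bot_iff]
    intro s hs
    have h1 : (s : E) ∈ K := by simpa [p] using hs
    have := Submodule.disjoint_def.1 hS _ h1 s.2
    exact (Submodule.mem_bot R).2 (Subtype.ext this)
  obtain ⟨h, hh⟩ := hE.out p hp S.subtype
  -- `h` is injective
  have hinj : LinearMap.ker h = ⊥ := by
    have hle : (LinearMap.ker h).comap K.mkQ ≤ K := by
      apply hKm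
      · refine Submodule.disjoint_def.2 fun x hx hxk => ?_
        have := hh ⟨x, hMS hx⟩
        have h2 : h (p ⟨x, hMS hx⟩) = 0 := by simpa [p] using hxk
        rw [h2] at this
        exact this.symm
      · intro x hx
        have : K.mkQ x = 0 := by simpa using hx
        simp only [Submodule.mem_comap, LinearMap.mem_ker, this, map_zero]
    rw [eq_bot_iff]
    intro y hy
    obtain ⟨x, rfl⟩ := K.mkQ_surjective y
    have : x ∈ K := hle hy
    simpa using this
  have hST : S ≤ LinearMap.range h := fun s hs => ⟨p ⟨s, hs⟩, hh ⟨s, hs⟩⟩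
  have hTS : LinearMap.range h ≤ S := by
    apply hSm _ _ hST
    refine Submodule.disjoint_def.2 fun x hxK hxT => ?_
    obtain ⟨y, rfl⟩ := hxT
    obtain ⟨x, rfl⟩ := K.mkQ_surjective y
    have hle : ((K.comap h).comap K.mkQ) ≤ K := by
      apply hKm
      · refine Submodule.disjoint_def.2 fun x hx hxk => ?_
        have h1 := hh ⟨x, hMS hx⟩
        have h2 : h (p ⟨x, hMS hx⟩) ∈ K := by simpa [p] using hxk
        rw [h1] at h2
        exact Submodule.disjoint_def.1 hK _ hx h2
      · intro x hx
        have : K.mkQ x = 0 := by simpa using hx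
        simp only [Submodule.mem_comap, this, zero_mem]
    have : x ∈ K := hle hxK
    have : K.mkQ x = 0 := by simpa using this
    rw [this, map_zero]
  let r : E →ₗ[R] S := (h ∘ₗ K.mkQ).codRestrict S (fun x => hTS ⟨_, rfl⟩)
  have hr : ∀ s : S, r s = s := fun s => Subtype.ext (hh s)
  refine ⟨ModuleCat.of R S, j.codRestrict S (fun x => hMS ⟨x, rfl⟩), ⟨?_⟩, ?_, ?_⟩
  · intro X Y _ _ _ _ f hf g
    obtain ⟨k, hk⟩ := hE.out f hf (S.subtype ∘ₗ g)
    exact ⟨r ∘ₗ k, fun x => by simpa [hk] using hr (g x)⟩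
  · intro a b hab
    exact hj (congrArg Subtype.val hab)
  · intro N hN
    have hle : K ⊔ N.map S.subtype ≤ K := by
      apply hKm _ _ le_sup_left
      refine Submodule.disjoint_def.2 fun x hx hx' => ?_
      obtain ⟨k, hk, n, hn, rfl⟩ := Submodule.mem_sup.1 hx'
      obtain ⟨n, hn, rfl⟩ := hn
      have hkS : k ∈ S := by
        have := S.sub_mem (hMS hx) n.2
        simpa using this
      have hk0 := Submodule.disjoint_def.1 hS _ hk hkS
      subst hk0
      obtain ⟨m, hm⟩ := hx
      have : n = 0 := by
        refine Submodule.disjoint_def.1 hN _ ⟨m, Subtype.ext ?_⟩ hn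
        simpa using hm
      simp [this]
    rw [eq_bot_iff]
    intro n hn
    have h1 : (n : E) ∈ K := hle (Submodule.mem_sup_right ⟨n, hn, rfl⟩)
    exact (Submodule.mem_bot R).2 (Subtype.ext (Submodule.disjoint_def.1 hS _ h1 n.2))

/-- A minimal injective cogenerator exists: the injective envelope of the direct sum of all simple
modules `R ⧸ 𝔪`. -/
theorem exists_isMinimalInjectiveCogenerator (R : Type u) [CommRing R] :
    ∃ I : ModuleCat.{u} R, IsMinimalInjectiveCogenerator R I := by
  classical
  let M₀ := DirectSum (MaximalSpectrum R) (fun m => R ⧸ m.asIdeal)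
  obtain ⟨S, i, hS, hi, hess⟩ := exists_injective_envelope (R := R) M₀
  refine ⟨S, ⟨hS, ?_⟩, ?_⟩
  · intro N _ _ x hx
    let f : R →ₗ[R] N := LinearMap.toSpanSingleton R N x
    have hne : LinearMap.ker f ≠ ⊤ := by
      intro h
      apply hx
      have : (1 : R) ∈ LinearMap.ker f := h ▸ Submodule.mem_top
      simpa [f] using this
    obtain ⟨m, hm, hle⟩ := Ideal.exists_le_maximal (LinearMap.ker f) hne
    let q : R ⧸ LinearMap.ker f →ₗ[R] R ⧸ m := Submodule.factor hle
    let g : R ⧸ LinearMap.ker f →ₗ[R] S :=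
      i ∘ₗ DirectSum.lof R (MaximalSpectrum R) (fun m => R ⧸ m.asIdeal) ⟨m, hm⟩ ∘ₗ q
    obtain ⟨h, hh⟩ := hS.out ((LinearMap.ker f).liftQ f le_rfl)
      (LinearMap.ker_eq_bot.1 (Submodule.ker_liftQ_eq_bot _ _ _ le_rfl)) g
    refine ⟨h, fun h0 => ?_⟩
    have h1 := hh (Submodule.Quotient.mk 1)
    have h2 : (LinearMap.ker f).liftQ f le_rfl (Submodule.Quotient.mk 1) = x := by
      exact (Submodule.liftQ_apply (LinearMap.ker f) f 1).trans (by simp [f])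
    rw [h2, h0] at h1
    have h3 : q (Submodule.Quotient.mk 1) = 0 := by
      apply DirectSum.of_injective (β := fun m : MaximalSpectrum R => R ⧸ m.asIdeal) ⟨m, hm⟩
      rw [map_zero]
      apply hi
      rw [map_zero]
      exact h1.symm
    have h4 : (Submodule.Quotient.mk 1 : R ⧸ m) = 0 := h3
    rw [Submodule.Quotient.mk_eq_zero] at h4
    exact hm.ne_top ((Ideal.eq_top_iff_one m).2 h4)
  · intro J _ _ hJ
    have key : ∀ m : MaximalSpectrum R, ∃ f : (R ⧸ m.asIdeal) →ₗ[R] J, f 1 ≠ 0 := fun m => by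
      apply hJ.2
      intro h
      exact m.isMaximal.ne_top ((Ideal.eq_top_iff_one _).2 (Ideal.Quotient.eq_zero_iff_mem.1 h))
    choose f hf using key
    let F : M₀ →ₗ[R] J := DirectSum.toModule R (MaximalSpectrum R) J f
    have hF : LinearMap.ker F = ⊥ := by
      rw [eq_bot_iff]
      intro x hx
      rw [Submodule.mem_bot]
      by_contra hx0
      obtain ⟨m, hm⟩ : ∃ m, x m ≠ 0 := by
        by_contra! h
        exact hx0 (DFinsupp.ext h)
      let I : Ideal R := (DFinsupp.support x \ {m}).inf (fun n => n.asIdeal)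
      have hI : ¬ I ≤ m.asIdeal := by
        intro h
        obtain ⟨n, hn, hnm⟩ := (Ideal.IsPrime.inf_le' m.isMaximal.isPrime).1 h
        have := n.isMaximal.eq_of_le m.isMaximal.ne_top hnm
        simp only [Finset.mem_sdiff, Finset.mem_singleton] at hn
        exact hn.2 (MaximalSpectrum.ext this)
      obtain ⟨r, hrI, hrm⟩ := Set.not_subset.1 hI
      have h1 : r • x = DirectSum.lof R _ (fun m : MaximalSpectrum R => R ⧸ m.asIdeal) m
          (r • x m) := by
        refine DFinsupp.ext fun n => ?_
        by_cases hnm : n = m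
        · subst hnm
          exact (DirectSum.of_eq_same (β := fun m : MaximalSpectrum R => R ⧸ m.asIdeal) n _).symm
        · refine Eq.trans ?_ (DirectSum.of_eq_of_ne
            (β := fun m : MaximalSpectrum R => R ⧸ m.asIdeal) m n _ hnm).symm
          change r • x n = 0
          by_cases hxn : x n = 0
          · rw [hxn, smul_zero]
          · have hr : r ∈ n.asIdeal := by
              have : I ≤ n.asIdeal := Finset.inf_le (by simp [hnm, hxn])
              exact this hrI
            obtain ⟨y, hy⟩ := Ideal.Quotient.mk_surjective (x n)
            rw [← hy]
            change Ideal.Quotient.mk _ (r * y) = 0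
            exact Ideal.Quotient.eq_zero_iff_mem.2 (Ideal.mul_mem_right _ _ hr)
      have h2 : f m (r • x m) = 0 := by
        have h3 : F (r • x) = 0 := by rw [map_smul, LinearMap.mem_ker.1 hx, smul_zero]
        rw [h1] at h3
        have h4 : F (DirectSum.lof R _ (fun m : MaximalSpectrum R => R ⧸ m.asIdeal) m (r • x m)) =
            f m (r • x m) := DirectSum.toModule_lof (M := fun m : MaximalSpectrum R => R ⧸ m.asIdeal) R m _
        exact h4.symm.trans h3
      obtain ⟨y, hy⟩ := Ideal.Quotient.mk_surjective (x m)
      have hym : r * y ∉ m.asIdeal := by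
        intro h
        rcases m.isMaximal.isPrime.mem_or_mem h with h | h
        · exact hrm h
        · exact hm (by rw [← hy]; exact Ideal.Quotient.eq_zero_iff_mem.2 h)
      obtain ⟨z, hz⟩ := (Ideal.Quotient.maximal_ideal_iff_isField_quotient m.asIdeal).1 m.isMaximal
        |>.mul_inv_cancel (a := Ideal.Quotient.mk m.asIdeal (r * y))
          (fun h => hym (Ideal.Quotient.eq_zero_iff_mem.1 h))
      obtain ⟨z, rfl⟩ := Ideal.Quotient.mk_surjective z
      apply hf m
      have h5 : (1 : R ⧸ m.asIdeal) = z • (r • x m) := by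
        rw [← hz, ← hy]
        change Ideal.Quotient.mk _ ((r * y) * z) = Ideal.Quotient.mk _ (z * (r * y))
        rw [mul_comm]
      rw [h5, map_smul, h2, smul_zero]
    obtain ⟨g, hg⟩ := hJ.1.out i hi F
    refine ⟨g, LinearMap.ker_eq_bot.1 (hess _ (Submodule.disjoint_def.2 ?_))⟩
    rintro _ ⟨x, rfl⟩ hx
    have : F x = 0 := by rw [← hg]; exact hx
    have : x ∈ LinearMap.ker F := this
    rw [hF, Submodule.mem_bot] at this
    rw [this, map_zero]

/-- The minimal injective cogenerator `I_R` of the category of `R`-modules (unique up to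
isomorphism). -/
noncomputable def minInjCogen (R : Type u) [CommRing R] : ModuleCat.{u} R :=
  (exists_isMinimalInjectiveCogenerator R).choose

theorem minInjCogen_spec (R : Type u) [CommRing R] :
    IsMinimalInjectiveCogenerator R (minInjCogen R) :=
  (exists_isMinimalInjectiveCogenerator R).choose_spec

/-- The dual `D M = Hom_R(M, I_R)` of an `R`-module. -/
abbrev IDual (R : Type u) [CommRing R] (M : Type v) [AddCommGroup M] [Module R M] :
    Type (max u v) :=
  M →ₗ[R] minInjCogen R

/-- `M` is a reflexive `R`-module: the canonical map `M → D (D M)`, `x ↦ (f ↦ f x)`, is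
bijective. -/
def IsIReflexive (R : Type u) [CommRing R] (M : Type v) [AddCommGroup M] [Module R M] : Prop :=
  Function.Bijective (LinearMap.applyₗ : M →ₗ[R] IDual R M →ₗ[R] minInjCogen R)

section Additive

variable {B : Type w} [Category.{v} B]

/-- `X` is strongly indecomposable: its endomorphism ring is local. -/
def StronglyIndecomposable [Preadditive B] (X : B) : Prop :=
  IsLocalRing (End X)

/-- Every object is a finite (possibly empty) direct sum of strongly indecomposable objects. -/
def IsKrullSchmidt (B : Type w) [Category.{v} B] [Preadditive B] : Prop :=
  ∀ X : B, ∃ (n : ℕ) (F : Fin n → B) (b : Limits.Bicone F),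
    (∀ i, StronglyIndecomposable (F i)) ∧ Nonempty b.IsBilimit ∧ Nonempty (X ≅ b.pt)

/-- `f : X ⟶ Y` is minimal left almost split. -/
structure IsMinimalLeftAlmostSplit {X Y : B} (f : X ⟶ Y) : Prop where
  minimal : ∀ h : Y ⟶ Y, f ≫ h = f → IsIso h
  not_section : ¬ IsSplitMono f
  factors : ∀ {M : B} (g : X ⟶ M), ¬ IsSplitMono g → ∃ h : Y ⟶ M, f ≫ h = g

/-- `g : Y ⟶ Z` is minimal right almost split. -/
structure IsMinimalRightAlmostSplit {Y Z : B} (g : Y ⟶ Z) : Prop where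
  minimal : ∀ h : Y ⟶ Y, h ≫ g = g → IsIso h
  not_retraction : ¬ IsSplitEpi g
  factors : ∀ {M : B} (f : M ⟶ Z), ¬ IsSplitEpi f → ∃ h : M ⟶ Y, h ≫ g = f

end Additive

namespace TriExact

section Preadditive

variable {A : Type w} [Category.{v} A] [Preadditive A] [HasShift A ℤ]

/-- `Ext¹(X, Y) = Hom_A(X, Y[1])` for objects `X`, `Y` of the full subcategory `C` of `A`. -/
abbrev Ext1 {C : ObjectProperty A} (X Y : C.FullSubcategory) : Type v :=
  X.obj ⟶ Y.obj⟦(1 : ℤ)⟧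

/-- `f` is injectively trivial: `Ext¹(M, f) = 0` for all `M` in `C`. -/
def InjTrivial {C : ObjectProperty A} {X Y : C.FullSubcategory} (f : X ⟶ Y) : Prop :=
  ∀ (M : C.FullSubcategory) (δ : Ext1 M X), δ ≫ f.hom⟦(1 : ℤ)⟧' = 0

/-- `f` is projectively trivial: `Ext¹(f, M) = 0` for all `M` in `C`. -/
def ProjTrivial {C : ObjectProperty A} {X Y : C.FullSubcategory} (f : X ⟶ Y) : Prop :=
  ∀ (M : C.FullSubcategory) (ζ : Ext1 Y M), f.hom ≫ ζ = 0

/-- `X` is Ext-injective. -/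
def IsExtInjective {C : ObjectProperty A} (X : C.FullSubcategory) : Prop :=
  InjTrivial (𝟙 X)

/-- `X` is Ext-projective. -/
def IsExtProjective {C : ObjectProperty A} (X : C.FullSubcategory) : Prop :=
  ProjTrivial (𝟙 X)

/-- Morphisms are related if their difference is injectively trivial. -/
def injRel (C : ObjectProperty A) : HomRel C.FullSubcategory :=
  fun _ _ f g => InjTrivial (f - g)

/-- Morphisms are related if their difference is projectively trivial. -/
def projRel (C : ObjectProperty A) : HomRel C.FullSubcategory :=
  fun _ _ f g => ProjTrivial (f - g)

/-- The injectively stable category `C / I_C`. -/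
abbrev InjStable (C : ObjectProperty A) : Type w := Quotient (injRel C)

/-- The projectively stable category `C / P_C`. -/
abbrev ProjStable (C : ObjectProperty A) : Type w := Quotient (projRel C)

theorem projRel_iff {C : ObjectProperty A} {X Y : C.FullSubcategory} (f g : X ⟶ Y) :
    projRel C f g ↔ ∀ (M : C.FullSubcategory) (ζ : Ext1 Y M), f.hom ≫ ζ = g.hom ≫ ζ := by
  refine forall₂_congr fun M ζ => ?_
  change (f.hom - g.hom) ≫ ζ = 0 ↔ _
  rw [Preadditive.sub_comp, sub_eq_zero]

instance (C : ObjectProperty A) : Congruence (projRel C) where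
  equivalence :=
    { refl := fun f => (projRel_iff _ _).2 fun _ _ => rfl
      symm := fun h => (projRel_iff _ _).2 fun M ζ => ((projRel_iff _ _).1 h M ζ).symm
      trans := fun h h' => (projRel_iff _ _).2 fun M ζ =>
        ((projRel_iff _ _).1 h M ζ).trans ((projRel_iff _ _).1 h' M ζ) }
  comp_left f g g' h := (projRel_iff _ _).2 fun M ζ => by
    simpa using f.hom ≫= (projRel_iff _ _).1 h M ζ
  comp_right g h := (projRel_iff _ _).2 fun M ζ => by
    simpa using (projRel_iff _ _).1 h M (g.hom ≫ ζ)

theorem projRel_add (C : ObjectProperty A) ⦃X Y : C.FullSubcategory⦄ (f₁ f₂ g₁ g₂ : X ⟶ Y)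
    (hf : projRel C f₁ f₂) (hg : projRel C g₁ g₂) : projRel C (f₁ + g₁) (f₂ + g₂) := by
  intro M ζ
  have h1 := hf M ζ
  have h2 := hg M ζ
  rw [add_sub_add_comm]
  change ((f₁ - f₂).hom + (g₁ - g₂).hom) ≫ ζ = 0
  rw [Preadditive.add_comp, h1, h2, add_zero]

instance (C : ObjectProperty A) : Preadditive (ProjStable C) :=
  Quotient.preadditive _ (projRel_add C)

instance (C : ObjectProperty A) : (Quotient.functor (projRel C)).Additive :=
  Quotient.functor_additive _ (projRel_add C)

section

variable [∀ n : ℤ, (shiftFunctor A n).Additive]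

theorem injRel_iff {C : ObjectProperty A} {X Y : C.FullSubcategory} (f g : X ⟶ Y) :
    injRel C f g ↔ ∀ (M : C.FullSubcategory) (δ : Ext1 M X),
      δ ≫ f.hom⟦(1 : ℤ)⟧' = δ ≫ g.hom⟦(1 : ℤ)⟧' := by
  refine forall₂_congr fun M δ => ?_
  change δ ≫ (f.hom - g.hom)⟦(1 : ℤ)⟧' = 0 ↔ _
  rw [Functor.map_sub, Preadditive.comp_sub, sub_eq_zero]

instance (C : ObjectProperty A) : Congruence (injRel C) where
  equivalence :=
    { refl := fun f => (injRel_iff _ _).2 fun _ _ => rfl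
      symm := fun h => (injRel_iff _ _).2 fun M δ => ((injRel_iff _ _).1 h M δ).symm
      trans := fun h h' => (injRel_iff _ _).2 fun M δ =>
        ((injRel_iff _ _).1 h M δ).trans ((injRel_iff _ _).1 h' M δ) }
  comp_left f g g' h := (injRel_iff _ _).2 fun M δ => by
    simpa using (injRel_iff _ _).1 h M (δ ≫ f.hom⟦(1 : ℤ)⟧')
  comp_right g h := (injRel_iff _ _).2 fun M δ => by
    simpa using (injRel_iff _ _).1 h M δ =≫ g.hom⟦(1 : ℤ)⟧'

theorem injRel_add (C : ObjectProperty A) ⦃X Y : C.FullSubcategory⦄ (f₁ f₂ g₁ g₂ : X ⟶ Y)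
    (hf : injRel C f₁ f₂) (hg : injRel C g₁ g₂) : injRel C (f₁ + g₁) (f₂ + g₂) := by
  refine (injRel_iff _ _).2 fun M δ => ?_
  change δ ≫ (f₁.hom + g₁.hom)⟦(1 : ℤ)⟧' = δ ≫ (f₂.hom + g₂.hom)⟦(1 : ℤ)⟧'
  rw [Functor.map_add, Functor.map_add, Preadditive.comp_add, Preadditive.comp_add,
    (injRel_iff _ _).1 hf, (injRel_iff _ _).1 hg]

instance (C : ObjectProperty A) : Preadditive (InjStable C) :=
  Quotient.preadditive _ (injRel_add C)

instance (C : ObjectProperty A) : (Quotient.functor (injRel C)).Additive :=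
  Quotient.functor_additive _ (injRel_add C)

/-- The product `g · δ = δ ≫ g[1]` of an extension `δ ∈ Ext¹(Z, X)` with a morphism `g : X ⟶ Y` of
the injectively stable category. -/
def push {C : ObjectProperty A} {X Y : InjStable C} (Z : C.FullSubcategory) (g : X ⟶ Y)
    (δ : Ext1 Z X.as) : Ext1 Z Y.as :=
  Quot.liftOn g (fun f => δ ≫ f.hom⟦(1 : ℤ)⟧') (fun f f' h =>
    (injRel_iff f f').1 ((HomRel.compClosure_iff_self (injRel C) f f').1 h) Z δ)

end

/-- The product `ζ · f = f ≫ ζ` of an extension `ζ ∈ Ext¹(Y, Z)` with a morphism `f : X ⟶ Y` of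
the projectively stable category. -/
def pull {C : ObjectProperty A} {X Y : ProjStable C} (Z : C.FullSubcategory) (f : X ⟶ Y)
    (ζ : Ext1 Y.as Z) : Ext1 X.as Z :=
  Quot.liftOn f (fun f => f.hom ≫ ζ) (fun f f' h =>
    (projRel_iff f f').1 ((HomRel.compClosure_iff_self (projRel C) f f').1 h) Z ζ)

end Preadditive

section Triangulated

variable {A : Type w} [Category.{v} A] [Preadditive A] [Limits.HasZeroObject A] [HasShift A ℤ]
  [∀ n : ℤ, (shiftFunctor A n).Additive] [Pretriangulated A]

/-- `X ⟶ Y ⟶ Z` is an almost split sequence in `C`: it embeds in an exact triangle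
`X ⟶ Y ⟶ Z ⟶ X[1]` of `A`, the morphism `f` is minimal left almost split in `C`, and the morphism
`g` is minimal right almost split in `C`. -/
structure IsAlmostSplitSequence {C : ObjectProperty A} {X Y Z : C.FullSubcategory}
    (f : X ⟶ Y) (g : Y ⟶ Z) : Prop where
  triExact : ∃ δ : Ext1 Z X,
    Pretriangulated.Triangle.mk f.hom g.hom δ ∈ Pretriangulated.distinguishedTriangles
  left : IsMinimalLeftAlmostSplit f
  right : IsMinimalRightAlmostSplit g

/-- Every strongly indecomposable object that is not Ext-projective is the ending term of an almost
split sequence. -/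
def HasAlmostSplitSequencesOnRight (C : ObjectProperty A) : Prop :=
  ∀ Z : C.FullSubcategory, StronglyIndecomposable Z → ¬ IsExtProjective Z →
    ∃ (X Y : C.FullSubcategory) (f : X ⟶ Y) (g : Y ⟶ Z), IsAlmostSplitSequence f g

/-- Every strongly indecomposable object that is not Ext-injective is the starting term of an almost
split sequence. -/
def HasAlmostSplitSequencesOnLeft (C : ObjectProperty A) : Prop :=
  ∀ X : C.FullSubcategory, StronglyIndecomposable X → ¬ IsExtInjective X →
    ∃ (Y Z : C.FullSubcategory) (f : X ⟶ Y) (g : Y ⟶ Z), IsAlmostSplitSequence f g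

/-- `C` has almost split sequences on the right and on the left. -/
def HasAlmostSplitSequences (C : ObjectProperty A) : Prop :=
  HasAlmostSplitSequencesOnRight C ∧ HasAlmostSplitSequencesOnLeft C

end Triangulated

section Linear

variable (R : Type u) [CommRing R] {A : Type w} [Category.{v} A] [Preadditive A] [Linear R A]
  [HasShift A ℤ] (C : ObjectProperty A)

theorem projRel_smul (a : R) ⦃X Y : C.FullSubcategory⦄ (f₁ f₂ : X ⟶ Y) (h : projRel C f₁ f₂) :
    projRel C (a • f₁) (a • f₂) := by
  intro M ζ
  rw [← smul_sub]
  change (a • (f₁ - f₂).hom) ≫ ζ = 0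
  rw [Linear.smul_comp, h M ζ, smul_zero]

instance : Linear R (ProjStable C) := Quotient.linear R _ (projRel_smul R C)

instance : (Quotient.functor (projRel C)).Linear R :=
  Quotient.linear_functor R _ (projRel_smul R C)

/-- All `Hom_C(X, Y)` are reflexive `R`-modules. -/
def HomReflexive : Prop :=
  ∀ X Y : C.FullSubcategory, IsIReflexive R (X ⟶ Y)

variable [∀ n : ℤ, (shiftFunctor A n).Additive] [∀ n : ℤ, (shiftFunctor A n).Linear R]

theorem injRel_smul (a : R) ⦃X Y : C.FullSubcategory⦄ (f₁ f₂ : X ⟶ Y) (h : injRel C f₁ f₂) :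
    injRel C (a • f₁) (a • f₂) := by
  refine (injRel_iff _ _).2 fun M δ => ?_
  change δ ≫ (a • f₁.hom)⟦(1 : ℤ)⟧' = δ ≫ (a • f₂.hom)⟦(1 : ℤ)⟧'
  rw [Functor.map_smul, Functor.map_smul, Linear.comp_smul, Linear.comp_smul,
    (injRel_iff _ _).1 h]

instance : Linear R (InjStable C) := Quotient.linear R _ (injRel_smul R C)

instance : (Quotient.functor (injRel C)).Linear R :=
  Quotient.linear_functor R _ (injRel_smul R C)

variable {C} in
/-- The object `X` of `C`, viewed in the projectively stable category. -/
abbrev toProj (X : C.FullSubcategory) : ProjStable C := (Quotient.functor (projRel C)).obj X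

variable {C} in
/-- The object `X` of `C`, viewed in the injectively stable category. -/
abbrev toInj (X : C.FullSubcategory) : InjStable C := (Quotient.functor (injRel C)).obj X

variable {C} in
/-- The class in the projectively stable category of a morphism of `C`. -/
abbrev projClass {X Y : C.FullSubcategory} (f : X ⟶ Y) : toProj X ⟶ toProj Y :=
  (Quotient.functor (projRel C)).map f

variable {C} in
/-- The class in the injectively stable category of a morphism of `C`. -/
abbrev injClass {X Y : C.FullSubcategory} (f : X ⟶ Y) : toInj X ⟶ toInj Y :=
  (Quotient.functor (injRel C)).map f

/-- A right Auslander-Reiten functor for `C`: an additive functor `τ` from the projectively stable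
to the injectively stable category with `R`-linear isomorphisms
`ProjStable(X, Y) ≅ D Ext¹(Y, τ X)`, natural in `X` and in `Y`. -/
structure RightARFunctor where
  τ : ProjStable C ⥤ InjStable C
  additive : τ.Additive
  iso (X Y : C.FullSubcategory) :
    (toProj X ⟶ toProj Y) ≃ₗ[R] IDual R (Ext1 Y (τ.obj (toProj X)).as)
  naturality_left {X X' Y : C.FullSubcategory} (f : X ⟶ X') (g : toProj X' ⟶ toProj Y)
    (ζ : Ext1 Y (τ.obj (toProj X)).as) :
    iso X Y (projClass f ≫ g) ζ = iso X' Y g (push Y (τ.map (projClass f)) ζ)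
  naturality_right {X Y Y' : C.FullSubcategory} (g : toProj X ⟶ toProj Y) (h : Y ⟶ Y')
    (ζ : Ext1 Y' (τ.obj (toProj X)).as) :
    iso X Y' (g ≫ projClass h) ζ = iso X Y g (h.hom ≫ ζ)

/-- A left Auslander-Reiten functor for `C`: an additive functor `τ` from the injectively stable
to the projectively stable category with `R`-linear isomorphisms
`InjStable(X, Y) ≅ D Ext¹(τ Y, X)`, natural in `X` and in `Y`. -/
structure LeftARFunctor where
  τ : InjStable C ⥤ ProjStable C
  additive : τ.Additive
  iso (X Y : C.FullSubcategory) :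
    (toInj X ⟶ toInj Y) ≃ₗ[R] IDual R (Ext1 (τ.obj (toInj Y)).as X)
  naturality_left {X X' Y : C.FullSubcategory} (f : X ⟶ X') (g : toInj X' ⟶ toInj Y)
    (ζ : Ext1 (τ.obj (toInj Y)).as X) :
    iso X Y (injClass f ≫ g) ζ = iso X' Y g (ζ ≫ f.hom⟦(1 : ℤ)⟧')
  naturality_right {X Y Y' : C.FullSubcategory} (g : toInj X ⟶ toInj Y) (h : Y ⟶ Y')
    (ζ : Ext1 (τ.obj (toInj Y')).as X) :
    iso X Y' (g ≫ injClass h) ζ = iso X Y g (pull X (τ.map (injClass h)) ζ)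

/-- A right Serre functor for `C`: an additive functor `S` from the projectively stable to the
injectively stable category with `R`-linear isomorphisms `ProjStable(X, Y) ≅ D InjStable(Y, S X)`,
natural in `X` and in `Y`. -/
structure RightSerreFunctor where
  S : ProjStable C ⥤ InjStable C
  additive : S.Additive
  iso (X Y : C.FullSubcategory) :
    (toProj X ⟶ toProj Y) ≃ₗ[R] IDual R (toInj Y ⟶ S.obj (toProj X))
  naturality_left {X X' Y : C.FullSubcategory} (f : X ⟶ X') (g : toProj X' ⟶ toProj Y)
    (u : toInj Y ⟶ S.obj (toProj X)) :
    iso X Y (projClass f ≫ g) u = iso X' Y g (u ≫ S.map (projClass f))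
  naturality_right {X Y Y' : C.FullSubcategory} (g : toProj X ⟶ toProj Y) (h : Y ⟶ Y')
    (u : toInj Y' ⟶ S.obj (toProj X)) :
    iso X Y' (g ≫ projClass h) u = iso X Y g (injClass h ≫ u)

/-- A left Serre functor for `C`: an additive functor `S` from the injectively stable to the
projectively stable category with `R`-linear isomorphisms `InjStable(X, Y) ≅ D ProjStable(S Y, X)`,
natural in `X` and in `Y`. -/
structure LeftSerreFunctor where
  S : InjStable C ⥤ ProjStable C
  additive : S.Additive
  iso (X Y : C.FullSubcategory) :
    (toInj X ⟶ toInj Y) ≃ₗ[R] IDual R (S.obj (toInj Y) ⟶ toProj X)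
  naturality_left {X X' Y : C.FullSubcategory} (f : X ⟶ X') (g : toInj X' ⟶ toInj Y)
    (u : S.obj (toInj Y) ⟶ toProj X) :
    iso X Y (injClass f ≫ g) u = iso X' Y g (u ≫ projClass f)
  naturality_right {X Y Y' : C.FullSubcategory} (g : toInj X ⟶ toInj Y) (h : Y ⟶ Y')
    (u : S.obj (toInj Y') ⟶ toProj X) :
    iso X Y' (g ≫ injClass h) u = iso X Y g (S.map (injClass h) ≫ u)

end Linear

end TriExact

/-!
The proof rests on one notion. A functional `θ` on `Ext¹(Z, X)` pairs `Hom(Z, Y)` with `Ext¹(Y, X)`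
by `(g, ζ) ↦ θ (g ≫ ζ)`, and `Hom(W, X)` with `Ext¹(Z, W)` by `(f, ζ) ↦ θ (ζ ≫ f[1])`. It is a
*right dual pair* (`IsRightDual`) if the first pairing identifies the projectively stable morphisms
`Z ⟶ Y` with `D Ext¹(Y, X)` for all `Y`, and a *left dual pair* (`IsLeftDual`) if the second one
identifies the injectively stable morphisms `W ⟶ X` with `D Ext¹(Z, W)` for all `W`. For right
triangulated `C` a right Auslander-Reiten functor amounts to a right dual pair for every `Z`.

*Dual pairs and almost split sequences.* If `δ ∈ Ext¹(Z, X)` is the class of an almost split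
sequence, every nonzero element of `Ext¹(Z, W)` can be pushed out to `δ`, and every nonzero element
of `Ext¹(W, X)` can be pulled back to `δ`. So any `θ` with `θ δ ≠ 0` gives a nondegenerate pairing,
and since the modules of extensions are reflexive the pairing is perfect
(`surjective_of_separating`, `isRightDual_of_killed`). Ext-projective objects are paired with `0`,
and dual pairs can be added, so by the Krull-Schmidt property every object has a right dual.
Conversely, for a right dual pair with `End Z` local and `Z` not Ext-projective, reflexivity turns
a functional on `End Z` that kills the non-isomorphisms but not `𝟙 Z` into an extension `δ ≠ 0`
killed by all non-retractions; projected to an indecomposable summand of `X` it is the class of an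
almost split sequence (`IsRightDual.exists_isAlmostSplitSequence`).

*Closure under the shift.* If `C` is right triangulated, it is closed under `[1]`, injectively
trivial morphisms vanish, and `Ext¹(Y, X)` is the reflexive module `Hom(Y, X[1])`. Functionals on
`Ext¹(Z, X')` are then represented by unique morphisms `X' ⟶ X` (`IsRightDual.exists_hom`). This
makes a choice of right dual pairs into a fully faithful functor, an Auslander-Reiten functor,
whose shift is a Serre functor. The left triangulated case is dual.

*Triangulated subcategories.* Here right and left dual pairs are the same thing and determine each
other's members up to isomorphism. Hence an Auslander-Reiten or Serre functor on one side is
essentially surjective exactly when the dual pairs of the other side exist for all objects.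
-/

set_option linter.unusedSectionVars false

/-! ### Duality over the minimal injective cogenerator -/

section Duality

variable {R : Type u} [CommRing R]

/-- Functionals with values in `minInjCogen R` separate the points of a module in any universe:
the cyclic submodule generated by a point lives in the universe of `R`, and functionals on it
extend by Baer's criterion. -/
theorem exists_dual_ne_zero {M : Type v} [AddCommGroup M] [Module R M] {x : M} (hx : x ≠ 0) :
    ∃ f : IDual R M, f x ≠ 0 := by
  obtain ⟨⟨hinj, hcog⟩, -⟩ := minInjCogen_spec R
  let q := LinearMap.toSpanSingleton R M x
  have h1 : (Submodule.Quotient.mk 1 : R ⧸ LinearMap.ker q) ≠ 0 := by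
    intro h
    rw [Submodule.Quotient.mk_eq_zero] at h
    exact hx (by simpa [q] using h)
  obtain ⟨f, hf⟩ := hcog _ _ h1
  let i : (R ⧸ LinearMap.ker q) →ₗ[R] M := (LinearMap.ker q).liftQ q le_rfl
  have hi : Function.Injective i :=
    LinearMap.ker_eq_bot.1 (Submodule.ker_liftQ_eq_bot _ _ _ le_rfl)
  obtain ⟨g, hg⟩ := (Module.Baer.of_injective hinj).extension_property i hi f
  refine ⟨g, fun h => hf ?_⟩
  rw [← hg]
  have : i (Submodule.Quotient.mk 1) = x :=
    (Submodule.liftQ_apply (LinearMap.ker q) q 1).trans (by simp [q])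
  rw [LinearMap.comp_apply, this, h]

theorem exists_dual_ne_zero_of_notMem {M : Type v} [AddCommGroup M] [Module R M]
    (N : Submodule R M) {x : M} (hx : x ∉ N) :
    ∃ f : IDual R M, (∀ y ∈ N, f y = 0) ∧ f x ≠ 0 := by
  have : N.mkQ x ≠ 0 := fun h => hx (by simpa using h)
  obtain ⟨f, hf⟩ := exists_dual_ne_zero (R := R) this
  refine ⟨f ∘ₗ N.mkQ, fun y hy => ?_, hf⟩
  have : N.mkQ y = 0 := by simpa using hy
  rw [LinearMap.comp_apply, this, map_zero]

theorem IsIReflexive.of_equiv {M : Type v} {N : Type w} [AddCommGroup M] [Module R M]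
    [AddCommGroup N] [Module R N] (e : M ≃ₗ[R] N) (hM : IsIReflexive R M) :
    IsIReflexive R N := by
  constructor
  · intro x y hxy
    apply e.symm.injective
    apply hM.1
    ext f
    simpa using LinearMap.congr_fun hxy (f ∘ₗ e.symm.toLinearMap)
  · intro F
    obtain ⟨x, hx⟩ := hM.2 (F ∘ₗ (LinearMap.lcomp R (minInjCogen R) e.symm.toLinearMap))
    refine ⟨e x, ?_⟩
    ext f
    have h := LinearMap.congr_fun hx (f ∘ₗ e.toLinearMap)
    have h2 : (LinearMap.lcomp R (minInjCogen R) e.symm.toLinearMap) (f ∘ₗ e.toLinearMap) = f := by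
      ext y; simp
    rw [LinearMap.comp_apply, h2] at h
    exact h

variable {H : Type v} {E : Type w} [AddCommGroup H] [Module R H] [AddCommGroup E] [Module R E]

/-- A pairing `H × E → I` with `E` reflexive that separates the points of `E` induces a surjection
`H → D E`: a functional on `D E` vanishing on the image is the evaluation at some `e ∈ E`
orthogonal to `H`. -/
theorem surjective_of_separating (hE : IsIReflexive R E) (B : H →ₗ[R] IDual R E)
    (hB : ∀ e, (∀ h, B h e = 0) → e = 0) : Function.Surjective B := by
  intro l
  by_contra hl
  obtain ⟨F, hF, hFl⟩ := exists_dual_ne_zero_of_notMem (LinearMap.range B)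
    (x := l) (fun ⟨h, hh⟩ => hl ⟨h, hh⟩)
  obtain ⟨e, rfl⟩ := hE.2 F
  have : e = 0 := hB e fun h => hF (B h) ⟨h, rfl⟩
  subst this
  exact hFl (by simp)

/-- If a pairing `H × E → I` with `E` reflexive induces a surjection `H → D E`, every functional on
`H` that kills the kernel of this surjection is given by an element of `E`. -/
theorem exists_eq_pairing (hE : IsIReflexive R E) (B : H →ₗ[R] IDual R E)
    (hB : Function.Surjective B) (l : IDual R H) (hl : ∀ h, B h = 0 → l h = 0) :
    ∃ e, ∀ h, l h = B h e := by
  let F : IDual R (IDual R E) := ((LinearMap.ker B).liftQ l hl) ∘ₗ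
    (B.quotKerEquivOfSurjective hB).symm.toLinearMap
  obtain ⟨e, he⟩ := hE.2 F
  refine ⟨e, fun h => ?_⟩
  have h1 : F (B h) = B h e := by rw [← he]; rfl
  rw [← h1]
  have h2 : (B.quotKerEquivOfSurjective hB).symm (B h) = Submodule.Quotient.mk h := by
    rw [LinearEquiv.symm_apply_eq]; rfl
  change _ = (LinearMap.ker B).liftQ l hl _
  erw [h2]
  exact (Submodule.liftQ_apply (LinearMap.ker B) l h).symm

theorem eq_zero_of_pairing_eq_zero (B : H →ₗ[R] IDual R E) (hB : Function.Surjective B) {e : E}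
    (he : ∀ h, B h e = 0) : e = 0 := by
  by_contra h
  obtain ⟨f, hf⟩ := exists_dual_ne_zero (R := R) h
  obtain ⟨g, rfl⟩ := hB f
  exact hf (he g)

end Duality

theorem LinearEquiv.exists_of_ker_eq {R H P Q : Type*} [CommRing R] [AddCommGroup H] [Module R H]
    [AddCommGroup P] [Module R P] [AddCommGroup Q] [Module R Q] (p : H →ₗ[R] P) (q : H →ₗ[R] Q)
    (hp : Function.Surjective p) (hq : Function.Surjective q) (h : ∀ x, p x = 0 ↔ q x = 0) :
    ∃ e : P ≃ₗ[R] Q, ∀ x, e (p x) = q x := by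
  have hk : LinearMap.ker p = LinearMap.ker q := by ext x; exact h x
  refine ⟨(p.quotKerEquivOfSurjective hp).symm ≪≫ₗ Submodule.quotEquivOfEq _ _ hk ≪≫ₗ
    q.quotKerEquivOfSurjective hq, fun x => ?_⟩
  have : (p.quotKerEquivOfSurjective hp).symm (p x) = Submodule.Quotient.mk x := by
    rw [LinearEquiv.symm_apply_eq]; rfl
  rw [LinearEquiv.trans_apply, LinearEquiv.trans_apply, this]
  rfl

/-! ### Objects with local endomorphism ring -/

namespace StronglyIndecomposable

variable {B : Type w} [Category.{v} B] [Preadditive B] {X : B}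

theorem isIso_or_isIso_of_add_eq_id (hX : StronglyIndecomposable X) {f g : X ⟶ X}
    (h : f + g = 𝟙 X) : IsIso f ∨ IsIso g := by
  have : IsLocalRing (End X) := hX
  exact (IsLocalRing.isUnit_or_isUnit_of_add_one (R := End X) (a := f) (b := g) h).imp
    (isUnit_iff_isIso _).1 (isUnit_iff_isIso _).1

theorem isIso_or_isIso_of_add (hX : StronglyIndecomposable X) {f g : X ⟶ X}
    (h : IsIso (f + g)) : IsIso f ∨ IsIso g := by
  have h1 : f ≫ inv (f + g) + g ≫ inv (f + g) = 𝟙 X := by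
    rw [← Preadditive.add_comp, IsIso.hom_inv_id]
  refine (hX.isIso_or_isIso_of_add_eq_id h1).imp (fun hf => ?_) (fun hg => ?_)
  · exact (isIso_comp_right_iff f (inv (f + g))).1 hf
  · exact (isIso_comp_right_iff g (inv (f + g))).1 hg

theorem id_ne_zero (hX : StronglyIndecomposable X) : 𝟙 X ≠ 0 := by
  have : IsLocalRing (End X) := hX
  exact one_ne_zero (α := End X)

theorem not_isIso_zero (hX : StronglyIndecomposable X) : ¬ IsIso (0 : X ⟶ X) := fun h => by
  have h1 := IsIso.hom_inv_id (0 : X ⟶ X)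
  rw [Limits.zero_comp] at h1
  exact hX.id_ne_zero h1.symm

/-- The non-isomorphisms in a local endomorphism ring form a submodule. -/
def nonIso (R : Type u) [CommRing R] [Linear R B] (hX : StronglyIndecomposable X) :
    Submodule R (X ⟶ X) where
  carrier := {f | ¬ IsIso f}
  zero_mem' := hX.not_isIso_zero
  add_mem' hf hg h := (hX.isIso_or_isIso_of_add h).elim hf hg
  smul_mem' r f hf h := hf <| by
    have h1 : f ≫ (r • inv (r • f)) = 𝟙 X := by
      rw [Linear.comp_smul, ← Linear.smul_comp, IsIso.hom_inv_id]
    have h2 : (r • inv (r • f)) ≫ f = 𝟙 X := by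
      rw [Linear.smul_comp, ← Linear.comp_smul, IsIso.inv_hom_id]
    exact ⟨_, h1, h2⟩

end StronglyIndecomposable

namespace TriExact

open Pretriangulated ObjectProperty

/-! ### Almost split extensions -/

section

variable {A : Type w} [Category.{v} A] [Preadditive A] [HasShift A ℤ] {C : ObjectProperty A}
  {X Y Z : C.FullSubcategory}

/-- `δ ∈ Ext¹(Z, X)` is annihilated by every morphism to `Z` that is not a retraction. -/
def KilledByNonretractions (δ : Ext1 Z X) : Prop :=
  ∀ ⦃M : C.FullSubcategory⦄ (f : M ⟶ Z), ¬ IsSplitEpi f → f.hom ≫ δ = 0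

/-- `δ ∈ Ext¹(Z, X)` is annihilated by every morphism from `X` that is not a section. -/
def KilledByNonsections (δ : Ext1 Z X) : Prop :=
  ∀ ⦃M : C.FullSubcategory⦄ (f : X ⟶ M), ¬ IsSplitMono f → δ ≫ f.hom⟦(1 : ℤ)⟧' = 0

/-- In a local endomorphism ring `h` or `1 - h` is invertible, and `1 - h` annihilates `δ`. -/
theorem isIso_of_comp_ext_eq (hZ : StronglyIndecomposable Z) {δ : Ext1 Z X} (hδ : δ ≠ 0)
    {h : Z ⟶ Z} (e : h.hom ≫ δ = δ) : IsIso h := by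
  refine (hZ.isIso_or_isIso_of_add_eq_id (add_sub_cancel h (𝟙 Z))).resolve_right fun hi => hδ ?_
  have h1 : (𝟙 Z - h).hom ≫ δ = 0 := by
    change (𝟙 Z.obj - h.hom) ≫ δ = 0
    rw [Preadditive.sub_comp, e, Category.id_comp, sub_self]
  rw [← cancel_epi (𝟙 Z - h).hom, h1, Limits.comp_zero]

variable [∀ n : ℤ, (shiftFunctor A n).Additive]

theorem isIso_of_ext_comp_shift_eq (hX : StronglyIndecomposable X) {δ : Ext1 Z X} (hδ : δ ≠ 0)
    {h : X ⟶ X} (e : δ ≫ h.hom⟦(1 : ℤ)⟧' = δ) : IsIso h := by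
  refine (hX.isIso_or_isIso_of_add_eq_id (add_sub_cancel h (𝟙 X))).resolve_right fun hi => hδ ?_
  have h1 : δ ≫ (𝟙 X - h).hom⟦(1 : ℤ)⟧' = 0 := by
    change δ ≫ (𝟙 X.obj - h.hom)⟦(1 : ℤ)⟧' = 0
    rw [Functor.map_sub, CategoryTheory.Functor.map_id, Preadditive.comp_sub, e,
      Category.comp_id, sub_self]
  rw [← cancel_mono ((𝟙 X - h).hom⟦(1 : ℤ)⟧'), h1, Limits.zero_comp]

variable [Limits.HasZeroObject A] [Pretriangulated A]

theorem exists_comp_eq_of_triangle {X Y Z : A} {f : X ⟶ Y} {g : Y ⟶ Z} {δ : Z ⟶ X⟦(1 : ℤ)⟧}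
    (hT : Triangle.mk f g δ ∈ distTriang A) {M : A} (q : X ⟶ M) (hq : δ ≫ q⟦(1 : ℤ)⟧' = 0) :
    ∃ s : Y ⟶ M, f ≫ s = q := by
  obtain ⟨t, ht⟩ : ∃ t : Y⟦(1 : ℤ)⟧ ⟶ M⟦(1 : ℤ)⟧, q⟦(1 : ℤ)⟧' = (-f⟦(1 : ℤ)⟧') ≫ t :=
    Triangle.yoneda_exact₃ _ (rot_of_distTriang _ hT) (q⟦(1 : ℤ)⟧') hq
  obtain ⟨s, hs⟩ := (shiftFunctor A (1 : ℤ)).map_surjective t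
  refine ⟨-s, (shiftFunctor A (1 : ℤ)).map_injective ?_⟩
  rw [Functor.map_comp, Functor.map_neg, hs, ht, Preadditive.comp_neg, Preadditive.neg_comp]

theorem exists_ext_comp_eq_of_triangle {X Y Z : A} {f : X ⟶ Y} {g : Y ⟶ Z}
    {δ : Z ⟶ X⟦(1 : ℤ)⟧} (hT : Triangle.mk f g δ ∈ distTriang A) {M : A}
    (q : Z ⟶ M⟦(1 : ℤ)⟧) (hq : g ≫ q = 0) : ∃ v : X ⟶ M, δ ≫ v⟦(1 : ℤ)⟧' = q := by
  obtain ⟨v, hv⟩ := Triangle.yoneda_exact₃ _ hT q hq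
  change q = δ ≫ v at hv
  obtain ⟨s, hs⟩ := (shiftFunctor A (1 : ℤ)).map_surjective (X := X) (Y := M) v
  exact ⟨s, by rw [hs, hv]⟩

/-- In an exact triangle, the second morphism is a retraction as soon as the third vanishes. -/
theorem isSplitEpi_of_triangle {f : X ⟶ Y} {g : Y ⟶ Z} {δ : Ext1 Z X}
    (hT : Triangle.mk f.hom g.hom δ ∈ distTriang A) (hδ : δ = 0) : IsSplitEpi g := by
  obtain ⟨s, hs⟩ := Triangle.coyoneda_exact₃ _ hT (𝟙 Z.obj) (by
    change 𝟙 _ ≫ δ = 0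
    rw [hδ, Limits.comp_zero])
  exact ⟨⟨C.homMk s, by ext; exact hs.symm⟩⟩

theorem ext_eq_zero_of_isSplitMono {f : X ⟶ Y} {g : Y ⟶ Z} {δ : Ext1 Z X}
    (hT : Triangle.mk f.hom g.hom δ ∈ distTriang A) (hf : IsSplitMono f) : δ = 0 := by
  have : IsSplitMono f.hom := ⟨⟨(retraction f).hom, by
    rw [← FullSubcategory.comp_hom, IsSplitMono.id, FullSubcategory.id_hom]⟩⟩
  exact Triangle.mor₃_eq_zero_of_mono₁ _ hT (inferInstanceAs (Mono f.hom))

theorem ext_eq_zero_of_isSplitEpi {f : X ⟶ Y} {g : Y ⟶ Z} {δ : Ext1 Z X}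
    (hT : Triangle.mk f.hom g.hom δ ∈ distTriang A) (hg : IsSplitEpi g) : δ = 0 := by
  have : IsSplitEpi g.hom := ⟨⟨(section_ g).hom, by
    rw [← FullSubcategory.comp_hom, IsSplitEpi.id, FullSubcategory.id_hom]⟩⟩
  exact Triangle.mor₃_eq_zero_of_epi₂ _ hT (inferInstanceAs (Epi g.hom))

theorem exists_triangle [C.IsTriangulatedClosed₂] (δ : Ext1 Z X) :
    ∃ (Y : C.FullSubcategory) (f : X ⟶ Y) (g : Y ⟶ Z),
      Triangle.mk f.hom g.hom δ ∈ distTriang A := by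
  obtain ⟨Y, hY, f, g, h⟩ := C.distinguished_cocone_triangle₂ δ X.property Z.property
  exact ⟨⟨Y, hY⟩, C.homMk f, C.homMk g, h⟩

/-- An extension killed by nonretractions factors through every nonzero extension of its first
argument: the pullback of `δ` along the middle term of `ζ` vanishes. -/
theorem KilledByNonretractions.exists_factor [C.IsTriangulatedClosed₂] {δ : Ext1 Z X}
    (hδ : KilledByNonretractions δ) {W : C.FullSubcategory} {ζ : Ext1 Z W} (hζ : ζ ≠ 0) :
    ∃ v : W ⟶ X, ζ ≫ v.hom⟦(1 : ℤ)⟧' = δ := by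
  obtain ⟨E, f, g, hT⟩ := exists_triangle ζ
  obtain ⟨v, hv⟩ := exists_ext_comp_eq_of_triangle hT δ
    (hδ g fun h => hζ (ext_eq_zero_of_isSplitEpi hT h))
  exact ⟨C.homMk v, hv⟩

/-- An extension killed by nonsections is a pullback of every nonzero extension with the same second
argument: the pushout of `δ` along the middle term of `ζ` vanishes. -/
theorem KilledByNonsections.exists_factor [C.IsTriangulatedClosed₂] {δ : Ext1 Z X}
    (hδ : KilledByNonsections δ) {W : C.FullSubcategory} {ζ : Ext1 W X} (hζ : ζ ≠ 0) :
    ∃ v : Z ⟶ W, v.hom ≫ ζ = δ := by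
  obtain ⟨E, f, g, hT⟩ := exists_triangle ζ
  obtain ⟨v, hv⟩ := Triangle.coyoneda_exact₁ _ hT δ
    (hδ f fun h => hζ (ext_eq_zero_of_isSplitMono hT h))
  exact ⟨C.homMk v, hv.symm⟩

/-- If the pushout of `δ` along `f : X ⟶ M` is nonzero, pushing it out further along some `M ⟶ X`
recovers `δ`. The resulting endomorphism of `X` fixes `δ ≠ 0`, so it is invertible. -/
theorem KilledByNonretractions.killedByNonsections [C.IsTriangulatedClosed₂] {δ : Ext1 Z X}
    (hδ : KilledByNonretractions δ) (h0 : δ ≠ 0) (hX : StronglyIndecomposable X) :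
    KilledByNonsections δ := by
  intro M f hf
  by_contra h
  obtain ⟨v, hv⟩ := hδ.exists_factor h
  have : IsIso (f ≫ v) := isIso_of_ext_comp_shift_eq hX h0 (by
    rw [FullSubcategory.comp_hom, Functor.map_comp, ← Category.assoc, hv])
  exact hf ⟨⟨v ≫ inv (f ≫ v), by rw [← Category.assoc, IsIso.hom_inv_id]⟩⟩

theorem KilledByNonsections.killedByNonretractions [C.IsTriangulatedClosed₂] {δ : Ext1 Z X}
    (hδ : KilledByNonsections δ) (h0 : δ ≠ 0) (hZ : StronglyIndecomposable Z) :
    KilledByNonretractions δ := by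
  intro M f hf
  by_contra h
  obtain ⟨v, hv⟩ := hδ.exists_factor h
  have : IsIso (v ≫ f) := isIso_of_comp_ext_eq hZ h0 (by
    rw [FullSubcategory.comp_hom, Category.assoc, hv])
  exact hf ⟨⟨inv (v ≫ f) ≫ v, by rw [Category.assoc, IsIso.inv_hom_id]⟩⟩

/-- A nonzero extension of objects with local endomorphism rings that is killed by nonretractions
and by nonsections is the class of an almost split sequence. -/
theorem exists_isAlmostSplitSequence [C.IsTriangulatedClosed₂] {δ : Ext1 Z X} (h0 : δ ≠ 0)
    (hX : StronglyIndecomposable X) (hZ : StronglyIndecomposable Z)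
    (hl : KilledByNonsections δ) (hr : KilledByNonretractions δ) :
    ∃ (Y : C.FullSubcategory) (f : X ⟶ Y) (g : Y ⟶ Z), IsAlmostSplitSequence f g := by
  obtain ⟨Y, f, g, hT⟩ := exists_triangle δ
  refine ⟨Y, f, g, ⟨δ, hT⟩, ⟨?_, ?_, ?_⟩, ⟨?_, ?_, ?_⟩⟩
  -- an endomorphism of `Y` fixing `f` extends to an endomorphism of the triangle; its component at
  -- `Z` fixes `δ`
  · intro h hh
    obtain ⟨c, hc₁, hc₂⟩ : ∃ c : Z.obj ⟶ Z.obj, g.hom ≫ c = h.hom ≫ g.hom ∧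
        δ ≫ (𝟙 X.obj)⟦(1 : ℤ)⟧' = c ≫ δ :=
      complete_distinguished_triangle_morphism _ _ hT hT (𝟙 X.obj) h.hom (by
        change f.hom ≫ h.hom = 𝟙 _ ≫ f.hom
        rw [← FullSubcategory.comp_hom, hh, Category.id_comp])
    have hc₃ : δ = c ≫ δ := by rw [← hc₂, CategoryTheory.Functor.map_id, Category.comp_id]
    have hci : IsIso (C.homMk c : Z ⟶ Z) := isIso_of_comp_ext_eq hZ h0 hc₃.symm
    have : IsIso c := (isIso_hom_iff _).2 hci
    let φ : Triangle.mk f.hom g.hom δ ⟶ Triangle.mk f.hom g.hom δ :=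
      { hom₁ := 𝟙 _, hom₂ := h.hom, hom₃ := c
        comm₁ := by
          change f.hom ≫ h.hom = 𝟙 _ ≫ f.hom
          rw [← FullSubcategory.comp_hom, hh, Category.id_comp]
        comm₂ := hc₁
        comm₃ := hc₂ }
    exact (isIso_hom_iff h).1
      (isIso₂_of_isIso₁₃ φ hT hT (inferInstanceAs (IsIso (𝟙 X.obj))) this)
  · exact fun h => h0 (ext_eq_zero_of_isSplitMono hT h)
  · intro M q hq
    obtain ⟨s, hs⟩ := exists_comp_eq_of_triangle hT q.hom (hl q hq)
    exact ⟨C.homMk s, by ext; exact hs⟩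
  · intro h hh
    obtain ⟨c, hc₁, hc₂⟩ : ∃ c : X.obj ⟶ X.obj, f.hom ≫ h.hom = c ≫ f.hom ∧
        δ ≫ c⟦(1 : ℤ)⟧' = 𝟙 Z.obj ≫ δ :=
      complete_distinguished_triangle_morphism₁ _ _ hT hT h.hom (𝟙 Z.obj) (by
        change g.hom ≫ 𝟙 _ = h.hom ≫ g.hom
        rw [← FullSubcategory.comp_hom, hh, Category.comp_id])
    have hc₃ : δ ≫ c⟦(1 : ℤ)⟧' = δ := by rw [hc₂, Category.id_comp]
    have hci : IsIso (C.homMk c : X ⟶ X) := isIso_of_ext_comp_shift_eq hX h0 hc₃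
    have : IsIso c := (isIso_hom_iff _).2 hci
    let φ : Triangle.mk f.hom g.hom δ ⟶ Triangle.mk f.hom g.hom δ :=
      { hom₁ := c, hom₂ := h.hom, hom₃ := 𝟙 _
        comm₁ := hc₁
        comm₂ := by
          change g.hom ≫ 𝟙 _ = h.hom ≫ g.hom
          rw [← FullSubcategory.comp_hom, hh, Category.comp_id]
        comm₃ := hc₂ }
    exact (isIso_hom_iff h).1
      (isIso₂_of_isIso₁₃ φ hT hT this (inferInstanceAs (IsIso (𝟙 Z.obj))))
  · exact fun h => h0 (ext_eq_zero_of_isSplitEpi hT h)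
  · intro M q hq
    obtain ⟨s, hs⟩ := Triangle.coyoneda_exact₃ _ hT q.hom (hr q hq)
    exact ⟨C.homMk s, by ext; exact hs.symm⟩

theorem IsAlmostSplitSequence.exists_ext {f : X ⟶ Y} {g : Y ⟶ Z} (h : IsAlmostSplitSequence f g) :
    ∃ δ : Ext1 Z X, δ ≠ 0 ∧ KilledByNonsections δ ∧ KilledByNonretractions δ := by
  obtain ⟨δ, hT⟩ := h.triExact
  refine ⟨δ, fun h0 => h.right.not_retraction (isSplitEpi_of_triangle hT h0), ?_, ?_⟩
  · intro M q hq
    obtain ⟨s, rfl⟩ := h.left.factors q hq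
    have : δ ≫ f.hom⟦(1 : ℤ)⟧' = 0 := comp_distTriang_mor_zero₃₁ _ hT
    rw [FullSubcategory.comp_hom, Functor.map_comp, reassoc_of% this, Limits.zero_comp]
  · intro M q hq
    obtain ⟨s, rfl⟩ := h.right.factors q hq
    have : g.hom ≫ δ = 0 := comp_distTriang_mor_zero₂₃ _ hT
    rw [FullSubcategory.comp_hom, Category.assoc, this, Limits.comp_zero]

end

end TriExact

namespace TriExact

open Pretriangulated ObjectProperty Limits ZeroObject

section DualPairs

variable {R : Type u} [CommRing R] {A : Type w} [Category.{v} A] [Preadditive A] [Linear R A]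
  [HasShift A ℤ] [∀ n : ℤ, (shiftFunctor A n).Additive] [∀ n : ℤ, (shiftFunctor A n).Linear R]
  {C : ObjectProperty A} {X Y Z : C.FullSubcategory}

/-! ### Dual pairs -/

/-- A functional `θ` on `Ext¹(Z, X)` pairs `Hom(Z, Y)` with `Ext¹(Y, X)`: the pair `(g, ζ)` is sent
to `θ (g ≫ ζ)`. -/
noncomputable def rightPairing (θ : IDual R (Ext1 Z X)) (Y : C.FullSubcategory) :
    (Z ⟶ Y) →ₗ[R] IDual R (Ext1 Y X) :=
  LinearMap.mk₂ R (fun g ζ => θ (g.hom ≫ ζ))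
    (fun g g' ζ => by
      change θ ((g.hom + g'.hom) ≫ ζ) = _
      rw [Preadditive.add_comp, map_add])
    (fun a g ζ => by
      change θ ((a • g.hom) ≫ ζ) = _
      rw [Linear.smul_comp, map_smul])
    (fun g ζ ζ' => by rw [Preadditive.comp_add, map_add])
    (fun a g ζ => by rw [Linear.comp_smul, map_smul])

/-- A functional `θ` on `Ext¹(Z, X)` pairs `Hom(W, X)` with `Ext¹(Z, W)`: the pair `(f, ζ)` is sent
to `θ (ζ ≫ f[1])`. -/
noncomputable def leftPairing (θ : IDual R (Ext1 Z X)) (W : C.FullSubcategory) :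
    (W ⟶ X) →ₗ[R] IDual R (Ext1 Z W) :=
  LinearMap.mk₂ R (fun f ζ => θ (ζ ≫ f.hom⟦(1 : ℤ)⟧'))
    (fun f f' ζ => by
      change θ (ζ ≫ (f.hom + f'.hom)⟦(1 : ℤ)⟧') = _
      rw [Functor.map_add, Preadditive.comp_add, map_add])
    (fun a f ζ => by
      change θ (ζ ≫ (a • f.hom)⟦(1 : ℤ)⟧') = _
      rw [Functor.map_smul, Linear.comp_smul, map_smul])
    (fun f ζ ζ' => by rw [Preadditive.add_comp, map_add])
    (fun a f ζ => by rw [Linear.smul_comp, map_smul])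

theorem rightPairing_apply (θ : IDual R (Ext1 Z X)) (g : Z ⟶ Y) (ζ : Ext1 Y X) :
    rightPairing θ Y g ζ = θ (g.hom ≫ ζ) := rfl

theorem leftPairing_apply (θ : IDual R (Ext1 Z X)) {W : C.FullSubcategory} (f : W ⟶ X)
    (ζ : Ext1 Z W) : leftPairing θ W f ζ = θ (ζ ≫ f.hom⟦(1 : ℤ)⟧') := rfl

/-- The functional `θ` on `Ext¹(Z, X)` induces isomorphisms from the projectively stable morphisms
`Z ⟶ Y` to `D Ext¹(Y, X)`, for all `Y`. In other words `X` has the defining property of the value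
at `Z` of a right Auslander-Reiten functor. -/
structure IsRightDual (θ : IDual R (Ext1 Z X)) : Prop where
  projTrivial : ∀ {Y : C.FullSubcategory} (g : Z ⟶ Y), rightPairing θ Y g = 0 → ProjTrivial g
  surjective : ∀ Y : C.FullSubcategory, Function.Surjective (rightPairing θ Y)

/-- The functional `θ` on `Ext¹(Z, X)` induces isomorphisms from the injectively stable morphisms
`W ⟶ X` to `D Ext¹(Z, W)`, for all `W`. In other words `Z` has the defining property of the value
at `X` of a left Auslander-Reiten functor. -/
structure IsLeftDual (θ : IDual R (Ext1 Z X)) : Prop where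
  injTrivial : ∀ {W : C.FullSubcategory} (f : W ⟶ X), leftPairing θ W f = 0 → InjTrivial f
  surjective : ∀ W : C.FullSubcategory, Function.Surjective (leftPairing θ W)

variable (R) in
/-- `Z` is the first member of a right dual pair. -/
def HasRightDual (Z : C.FullSubcategory) : Prop :=
  ∃ (X : C.FullSubcategory) (θ : IDual R (Ext1 Z X)), IsRightDual θ

variable (R) in
/-- `X` is the second member of a left dual pair. -/
def HasLeftDual (X : C.FullSubcategory) : Prop :=
  ∃ (Z : C.FullSubcategory) (θ : IDual R (Ext1 Z X)), IsLeftDual θ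

theorem rightPairing_eq_zero_of_projTrivial (θ : IDual R (Ext1 Z X)) {g : Z ⟶ Y}
    (hg : ProjTrivial g) : rightPairing θ Y g = 0 := by
  ext ζ
  rw [rightPairing_apply, hg, map_zero, LinearMap.zero_apply]

theorem leftPairing_eq_zero_of_injTrivial (θ : IDual R (Ext1 Z X)) {W : C.FullSubcategory}
    {f : W ⟶ X} (hf : InjTrivial f) : leftPairing θ W f = 0 := by
  ext ζ
  rw [leftPairing_apply, hf, map_zero, LinearMap.zero_apply]

/-! #### Transport along isomorphisms -/

theorem ProjTrivial.comp {f : X ⟶ Y} (hf : ProjTrivial f) (g : Y ⟶ Z) : ProjTrivial (f ≫ g) :=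
  fun M ζ => by rw [FullSubcategory.comp_hom, Category.assoc, hf M (g.hom ≫ ζ)]

theorem ProjTrivial.precomp {g : Y ⟶ Z} (hg : ProjTrivial g) (f : X ⟶ Y) :
    ProjTrivial (f ≫ g) :=
  fun M ζ => by rw [FullSubcategory.comp_hom, Category.assoc, hg M ζ, comp_zero]

theorem InjTrivial.comp {f : X ⟶ Y} (hf : InjTrivial f) (g : Y ⟶ Z) : InjTrivial (f ≫ g) :=
  fun M ζ => by
    rw [FullSubcategory.comp_hom, Functor.map_comp, reassoc_of% (hf M ζ), zero_comp]

theorem InjTrivial.precomp {g : Y ⟶ Z} (hg : InjTrivial g) (f : X ⟶ Y) :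
    InjTrivial (f ≫ g) :=
  fun M ζ => by
    rw [FullSubcategory.comp_hom, Functor.map_comp, ← Category.assoc, hg M]

theorem HasRightDual.of_iso {Z' : C.FullSubcategory} (h : HasRightDual R Z) (e : Z' ≅ Z) :
    HasRightDual R Z' := by
  obtain ⟨X, θ, hθ⟩ := h
  have key : ∀ {Y : C.FullSubcategory} (g : Z' ⟶ Y),
      rightPairing (θ ∘ₗ Linear.leftComp R _ e.inv.hom) Y g = rightPairing θ Y (e.inv ≫ g) := by
    intro Y g
    ext ζ
    change θ (e.inv.hom ≫ g.hom ≫ ζ) = θ ((e.inv.hom ≫ g.hom) ≫ ζ)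
    rw [Category.assoc]
  refine ⟨X, θ ∘ₗ Linear.leftComp R _ e.inv.hom, fun g hg => ?_, fun Y l => ?_⟩
  · rw [key] at hg
    simpa using (hθ.projTrivial _ hg).precomp e.hom
  · obtain ⟨g, rfl⟩ := hθ.surjective Y l
    exact ⟨e.hom ≫ g, by rw [key, Iso.inv_hom_id_assoc]⟩

theorem HasLeftDual.of_iso {X' : C.FullSubcategory} (h : HasLeftDual R X) (e : X ≅ X') :
    HasLeftDual R X' := by
  obtain ⟨Z, θ, hθ⟩ := h
  have key : ∀ {W : C.FullSubcategory} (f : W ⟶ X'),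
      leftPairing (θ ∘ₗ Linear.rightComp R _ (e.inv.hom⟦(1 : ℤ)⟧')) W f =
        leftPairing θ W (f ≫ e.inv) := by
    intro W f
    ext ζ
    change θ ((ζ ≫ f.hom⟦(1 : ℤ)⟧') ≫ e.inv.hom⟦(1 : ℤ)⟧') = θ (ζ ≫ (f.hom ≫ e.inv.hom)⟦(1 : ℤ)⟧')
    rw [Functor.map_comp, Category.assoc]
  refine ⟨Z, θ ∘ₗ Linear.rightComp R _ (e.inv.hom⟦(1 : ℤ)⟧'), fun f hf => ?_, fun W l => ?_⟩
  · rw [key] at hf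
    simpa using (hθ.injTrivial _ hf).comp e.hom
  · obtain ⟨f, rfl⟩ := hθ.surjective W l
    exact ⟨f ≫ e.hom, by rw [key, Category.assoc, Iso.hom_inv_id, Category.comp_id]⟩

/-! #### Direct sums -/

theorem sum_hom {ι : Type*} (s : Finset ι) (f : ι → (X ⟶ Y)) :
    (∑ i ∈ s, f i).hom = ∑ i ∈ s, (f i).hom :=
  map_sum (InducedCategory.homAddEquiv (X := X) (Y := Y)) f s

theorem ext_comp_sum_shift {ι : Type*} (s : Finset ι) (f : ι → (X ⟶ Y)) (ζ : Ext1 Z X) :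
    ζ ≫ (∑ i ∈ s, f i).hom⟦(1 : ℤ)⟧' = ∑ i ∈ s, ζ ≫ (f i).hom⟦(1 : ℤ)⟧' := by
  rw [sum_hom, Functor.map_sum, Preadditive.comp_sum]

theorem bicone_ι_π_hom_self {J : Type} {F : J → C.FullSubcategory} (b : Bicone F) (i : J) :
    (b.ι i).hom ≫ (b.π i).hom = 𝟙 _ := by
  rw [← FullSubcategory.comp_hom, bicone_ι_π_self, FullSubcategory.id_hom]

theorem bicone_ι_π_hom_of_ne {J : Type} {F : J → C.FullSubcategory} (b : Bicone F) {i j : J}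
    (h : i ≠ j) : (b.ι i).hom ≫ (b.π j).hom = 0 := by
  rw [← FullSubcategory.comp_hom, bicone_ι_π_ne b h]; rfl

/-- Right dual pairs can be added: the functional on `Ext¹(⨁ F i, ⨁ G i)` is the sum of the given
functionals over the diagonal components. -/
theorem hasRightDual_of_isBilimit {J : Type} [Fintype J] {F : J → C.FullSubcategory}
    {b : Bicone F} (hb : b.IsBilimit) [HasFiniteBiproducts C.FullSubcategory]
    (hF : ∀ i, HasRightDual R (F i)) : HasRightDual R b.pt := by
  choose G θ hθ using hF
  let c := biproduct.bicone G
  have hc : ∑ j, c.π j ≫ c.ι j = 𝟙 c.pt := IsBilimit.total (biproduct.isBilimit G)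
  let Θ : IDual R (Ext1 b.pt c.pt) := ∑ i, θ i ∘ₗ
    Linear.leftComp R _ (b.ι i).hom ∘ₗ Linear.rightComp R _ ((c.π i).hom⟦(1 : ℤ)⟧')
  have hΘ : ∀ ζ, Θ ζ = ∑ i, θ i ((b.ι i).hom ≫ ζ ≫ (c.π i).hom⟦(1 : ℤ)⟧') := fun ζ => by
    simp [Θ]
  refine ⟨c.pt, Θ, fun {Y} g hg => ?_, fun Y l => ?_⟩
  · have h1 : ∀ i, ProjTrivial (b.ι i ≫ g) := fun i => by
      refine (hθ i).projTrivial _ (LinearMap.ext fun ζ => ?_)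
      have h2 := LinearMap.congr_fun hg (ζ ≫ (c.ι i).hom⟦(1 : ℤ)⟧')
      rw [rightPairing_apply, hΘ, Finset.sum_eq_single i] at h2
      · rw [Category.assoc, Category.assoc, ← Functor.map_comp, bicone_ι_π_hom_self,
          CategoryTheory.Functor.map_id, Category.comp_id] at h2
        rw [rightPairing_apply, FullSubcategory.comp_hom, Category.assoc]
        exact h2
      · intro j _ hj
        rw [Category.assoc, Category.assoc, ← Functor.map_comp, bicone_ι_π_hom_of_ne c hj.symm]
        simp
      · simp
    intro M ζ
    have h2 : g = ∑ i, b.π i ≫ b.ι i ≫ g := by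
      simp_rw [← Category.assoc]
      rw [← Preadditive.sum_comp, IsBilimit.total hb, Category.id_comp]
    rw [h2, sum_hom, Preadditive.sum_comp]
    exact Finset.sum_eq_zero fun i _ => (h1 i).precomp (b.π i) M ζ
  · choose g hg using fun i => (hθ i).surjective Y
      (l ∘ₗ Linear.rightComp R _ ((c.ι i).hom⟦(1 : ℤ)⟧'))
    refine ⟨∑ i, b.π i ≫ g i, LinearMap.ext fun ζ => ?_⟩
    have h1 : ∀ i, (b.ι i).hom ≫ (∑ j, b.π j ≫ g j).hom = (g i).hom := fun i => by
      rw [← FullSubcategory.comp_hom, Preadditive.comp_sum, Finset.sum_eq_single i]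
      · rw [← Category.assoc, bicone_ι_π_self, Category.id_comp]
      · intro j _ hj
        rw [← Category.assoc, bicone_ι_π_ne b hj.symm, zero_comp]
      · simp
    have h2 : ζ = ∑ i, (ζ ≫ (c.π i).hom⟦(1 : ℤ)⟧') ≫ (c.ι i).hom⟦(1 : ℤ)⟧' := by
      have := ext_comp_sum_shift Finset.univ (fun j => c.π j ≫ c.ι j) ζ
      rw [hc, FullSubcategory.id_hom, CategoryTheory.Functor.map_id, Category.comp_id] at this
      simpa using this
    rw [rightPairing_apply, hΘ]
    conv_rhs => rw [h2, map_sum]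
    refine Finset.sum_congr rfl fun i _ => ?_
    have h3 := LinearMap.congr_fun (hg i) (ζ ≫ (c.π i).hom⟦(1 : ℤ)⟧')
    rw [Category.assoc, ← Category.assoc (b.ι i).hom, h1]
    exact h3

theorem hasLeftDual_of_isBilimit {J : Type} [Fintype J] {F : J → C.FullSubcategory}
    {b : Bicone F} (hb : b.IsBilimit) [HasFiniteBiproducts C.FullSubcategory]
    (hF : ∀ i, HasLeftDual R (F i)) : HasLeftDual R b.pt := by
  choose G θ hθ using hF
  let c := biproduct.bicone G
  have hc : ∑ j, c.π j ≫ c.ι j = 𝟙 c.pt := IsBilimit.total (biproduct.isBilimit G)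
  let Θ : IDual R (Ext1 c.pt b.pt) := ∑ i, θ i ∘ₗ
    Linear.leftComp R _ (c.ι i).hom ∘ₗ Linear.rightComp R _ ((b.π i).hom⟦(1 : ℤ)⟧')
  have hΘ : ∀ ζ, Θ ζ = ∑ i, θ i ((c.ι i).hom ≫ ζ ≫ (b.π i).hom⟦(1 : ℤ)⟧') := fun ζ => by
    simp [Θ]
  refine ⟨c.pt, Θ, fun {W} f hf => ?_, fun W l => ?_⟩
  · have h1 : ∀ i, InjTrivial (f ≫ b.π i) := fun i => by
      refine (hθ i).injTrivial _ (LinearMap.ext fun ζ => ?_)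
      have h2 := LinearMap.congr_fun hf ((c.π i).hom ≫ ζ)
      rw [leftPairing_apply, hΘ, Finset.sum_eq_single i] at h2
      · rw [← Category.assoc, ← Category.assoc, ← Category.assoc, bicone_ι_π_hom_self,
          Category.id_comp, Category.assoc, ← Functor.map_comp] at h2
        exact h2
      · intro j _ hj
        rw [← Category.assoc, ← Category.assoc, ← Category.assoc, bicone_ι_π_hom_of_ne c hj]
        simp
      · simp
    intro M ζ
    have h2 : f = ∑ i, (f ≫ b.π i) ≫ b.ι i := by
      simp_rw [Category.assoc]
      rw [← Preadditive.comp_sum, IsBilimit.total hb, Category.comp_id]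
    rw [h2, ext_comp_sum_shift]
    exact Finset.sum_eq_zero fun i _ => (h1 i).comp (b.ι i) M ζ
  · choose f hf using fun i => (hθ i).surjective W
      (l ∘ₗ Linear.leftComp R _ (c.π i).hom)
    refine ⟨∑ i, f i ≫ b.ι i, LinearMap.ext fun ζ => ?_⟩
    have h1 : ∀ i, (∑ j, f j ≫ b.ι j).hom ≫ (b.π i).hom = (f i).hom := fun i => by
      rw [← FullSubcategory.comp_hom, Preadditive.sum_comp, Finset.sum_eq_single i]
      · rw [Category.assoc, bicone_ι_π_self, Category.comp_id]
      · intro j _ hj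
        rw [Category.assoc, bicone_ι_π_ne b hj, comp_zero]
      · simp
    have h2 : ζ = ∑ i, (c.π i).hom ≫ (c.ι i).hom ≫ ζ := by
      have := congrArg (fun t => t.hom ≫ ζ) hc
      simp only [sum_hom, Preadditive.sum_comp, FullSubcategory.id_hom, Category.id_comp,
        FullSubcategory.comp_hom, Category.assoc] at this
      exact this.symm
    rw [leftPairing_apply, hΘ]
    conv_rhs => rw [h2, map_sum]
    refine Finset.sum_congr rfl fun i _ => ?_
    have h3 := LinearMap.congr_fun (hf i) ((c.ι i).hom ≫ ζ)
    rw [Category.assoc ζ, ← Functor.map_comp, h1, ← Category.assoc]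
    exact h3

/-! ### Dual pairs and almost split sequences -/

/-- The zero object is a right dual of an Ext-projective object. -/
theorem hasRightDual_of_isExtProjective [C.ContainsZero] [C.IsClosedUnderIsomorphisms]
    [HasZeroObject A] (hZ : IsExtProjective Z) : HasRightDual R Z := by
  have h0 : IsZero ((0 : A)⟦(1 : ℤ)⟧) := (shiftFunctor A (1 : ℤ)).map_isZero (isZero_zero A)
  refine ⟨⟨0, C.prop_of_isZero (isZero_zero A)⟩, 0, fun g _ => ?_, fun Y l => ⟨0, ?_⟩⟩
  · simpa using ProjTrivial.comp hZ g
  · ext ζ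
    rw [h0.eq_of_tgt ζ 0, map_zero, map_zero]

theorem hasLeftDual_of_isExtInjective [C.ContainsZero] [C.IsClosedUnderIsomorphisms]
    [HasZeroObject A] (hX : IsExtInjective X) : HasLeftDual R X := by
  refine ⟨⟨0, C.prop_of_isZero (isZero_zero A)⟩, 0, fun f _ => ?_, fun Y l => ⟨0, ?_⟩⟩
  · simpa using InjTrivial.precomp hX f
  · ext ζ
    rw [(isZero_zero A).eq_of_src ζ 0, map_zero, map_zero]

section

variable [HasZeroObject A] [Pretriangulated A] [C.IsTriangulatedClosed₂]
  (hE : ∀ X Y : C.FullSubcategory, IsIReflexive R (Ext1 X Y))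
include hE

/-- The class of an almost split sequence ending in `Z` and starting in `X` gives a right dual
pair: each nonzero element of `Hom(Z, Y)` or `Ext¹(Y, X)` can be multiplied into `δ`, so that the
pairing is nondegenerate, and reflexivity makes it perfect. -/
theorem isRightDual_of_killed {δ : Ext1 Z X} (hl : KilledByNonsections δ)
    (hr : KilledByNonretractions δ) {θ : IDual R (Ext1 Z X)} (hθ : θ δ ≠ 0) : IsRightDual θ where
  projTrivial {Y} g hg M ζ := by
    by_contra h
    obtain ⟨v, hv⟩ := hr.exists_factor h
    apply hθ
    rw [← hv, Category.assoc]
    exact LinearMap.congr_fun hg (ζ ≫ v.hom⟦(1 : ℤ)⟧')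
  surjective Y := surjective_of_separating (hE _ _) _ fun ζ h => by
    by_contra hζ
    obtain ⟨g, hg⟩ := hl.exists_factor hζ
    apply hθ
    rw [← hg]
    exact h g

theorem isLeftDual_of_killed {δ : Ext1 Z X} (hl : KilledByNonsections δ)
    (hr : KilledByNonretractions δ) {θ : IDual R (Ext1 Z X)} (hθ : θ δ ≠ 0) : IsLeftDual θ where
  injTrivial {W} f hf M ζ := by
    by_contra h
    obtain ⟨v, hv⟩ := hl.exists_factor h
    apply hθ
    rw [← hv, ← Category.assoc]
    exact LinearMap.congr_fun hf (v.hom ≫ ζ)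
  surjective W := surjective_of_separating (hE _ _) _ fun ζ h => by
    by_contra hζ
    obtain ⟨f, hf⟩ := hr.exists_factor hζ
    apply hθ
    rw [← hf]
    exact h f

/-- The almost split extension attached to a right dual pair `(Z, X, θ)` corresponds to a
functional on `End Z` that kills the non-isomorphisms but not the identity. As `X` need not be
indecomposable, the extension is projected to an indecomposable summand of `X`. -/
theorem IsRightDual.exists_isAlmostSplitSequence (hKS : IsKrullSchmidt C.FullSubcategory)
    (hZ : StronglyIndecomposable Z) (hp : ¬ IsExtProjective Z) {θ : IDual R (Ext1 Z X)}
    (hθ : IsRightDual θ) : ∃ (X Y : C.FullSubcategory) (f : X ⟶ Y) (g : Y ⟶ Z),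
      IsAlmostSplitSequence f g := by
  obtain ⟨l, hl0, hl1⟩ := exists_dual_ne_zero_of_notMem (hZ.nonIso R) (x := 𝟙 Z)
    (fun h => h inferInstance)
  -- since `Z` is not Ext-projective, no isomorphism is in the kernel of the pairing
  obtain ⟨δ, hδ⟩ := exists_eq_pairing (hE _ _) (rightPairing θ Z) (hθ.surjective Z) l
    (fun h hh => hl0 h fun hi => hp <| by
      simpa [IsExtProjective] using (hθ.projTrivial h hh).precomp (inv h))
  have hδ0 : δ ≠ 0 := fun h => hl1 (by rw [hδ, h, map_zero])
  have hr : KilledByNonretractions δ := by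
    intro M f hf
    by_contra hne
    obtain ⟨μ, hμ⟩ := exists_dual_ne_zero (R := R) hne
    obtain ⟨g, rfl⟩ := hθ.surjective M μ
    apply hμ
    rw [rightPairing_apply, ← Category.assoc]
    refine (hδ (g ≫ f)).symm.trans (hl0 _ fun h => hf ?_)
    exact ⟨⟨inv (g ≫ f) ≫ g, by rw [Category.assoc, IsIso.inv_hom_id]⟩⟩
  obtain ⟨n, F, b, hF, ⟨hb⟩, ⟨e⟩⟩ := hKS X
  -- some component of `δ` is nonzero, and it is still killed by nonretractions
  obtain ⟨i, hi⟩ : ∃ i, δ ≫ (e.hom ≫ b.π i).hom⟦(1 : ℤ)⟧' ≠ 0 := by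
    by_contra! h
    apply hδ0
    have h1 : δ ≫ (∑ i, (e.hom ≫ b.π i) ≫ b.ι i ≫ e.inv).hom⟦(1 : ℤ)⟧' = 0 := by
      rw [ext_comp_sum_shift]
      refine Finset.sum_eq_zero fun i _ => ?_
      rw [FullSubcategory.comp_hom, Functor.map_comp, reassoc_of% (h i), zero_comp]
    have h2 : ∑ i, (e.hom ≫ b.π i) ≫ b.ι i ≫ e.inv = 𝟙 X := by
      have h3 := IsBilimit.total hb
      calc _ = e.hom ≫ (∑ i, b.π i ≫ b.ι i) ≫ e.inv := by
            simp only [Preadditive.comp_sum, Preadditive.sum_comp, Category.assoc]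
        _ = _ := by rw [h3, Category.id_comp, Iso.hom_inv_id]
    rwa [h2, FullSubcategory.id_hom, CategoryTheory.Functor.map_id, Category.comp_id] at h1
  have hr' : KilledByNonretractions (X := F i) (δ ≫ (e.hom ≫ b.π i).hom⟦(1 : ℤ)⟧') :=
    fun M f hf => by rw [← Category.assoc, hr f hf, zero_comp]
  exact ⟨F i, TriExact.exists_isAlmostSplitSequence hi (hF i) hZ
    (hr'.killedByNonsections hi (hF i)) hr'⟩

/-- The almost split extension attached to a left dual pair `(Z, X, θ)` corresponds to a functional
on `End X` that kills the non-isomorphisms but not the identity; it is restricted to an indecomposable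
summand of `Z`. -/
theorem IsLeftDual.exists_isAlmostSplitSequence (hKS : IsKrullSchmidt C.FullSubcategory)
    (hX : StronglyIndecomposable X) (hp : ¬ IsExtInjective X) {θ : IDual R (Ext1 Z X)}
    (hθ : IsLeftDual θ) : ∃ (Y Z : C.FullSubcategory) (f : X ⟶ Y) (g : Y ⟶ Z),
      IsAlmostSplitSequence f g := by
  obtain ⟨l, hl0, hl1⟩ := exists_dual_ne_zero_of_notMem (hX.nonIso R) (x := 𝟙 X)
    (fun h => h inferInstance)
  obtain ⟨δ, hδ⟩ := exists_eq_pairing (hE _ _) (leftPairing θ X) (hθ.surjective X) l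
    (fun h hh => hl0 h fun hi => hp <| by
      simpa [IsExtInjective] using (hθ.injTrivial h hh).comp (inv h))
  have hδ0 : δ ≠ 0 := fun h => hl1 (by rw [hδ, h, map_zero])
  have hl : KilledByNonsections δ := by
    intro M q hq
    by_contra hne
    obtain ⟨μ, hμ⟩ := exists_dual_ne_zero (R := R) hne
    obtain ⟨g, rfl⟩ := hθ.surjective M μ
    apply hμ
    rw [leftPairing_apply, Category.assoc, ← Functor.map_comp]
    refine (hδ (q ≫ g)).symm.trans (hl0 _ fun h => hq ?_)
    exact ⟨⟨g ≫ inv (q ≫ g), by rw [← Category.assoc, IsIso.hom_inv_id]⟩⟩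
  obtain ⟨n, F, b, hF, ⟨hb⟩, ⟨e⟩⟩ := hKS Z
  obtain ⟨i, hi⟩ : ∃ i, (b.ι i ≫ e.inv).hom ≫ δ ≠ 0 := by
    by_contra! h
    apply hδ0
    have h1 : (∑ i, (e.hom ≫ b.π i) ≫ b.ι i ≫ e.inv).hom ≫ δ = 0 := by
      rw [sum_hom, Preadditive.sum_comp]
      refine Finset.sum_eq_zero fun i _ => ?_
      rw [FullSubcategory.comp_hom, Category.assoc, h i, comp_zero]
    have h2 : ∑ i, (e.hom ≫ b.π i) ≫ b.ι i ≫ e.inv = 𝟙 Z := by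
      have h3 := IsBilimit.total hb
      calc _ = e.hom ≫ (∑ i, b.π i ≫ b.ι i) ≫ e.inv := by
            simp only [Preadditive.comp_sum, Preadditive.sum_comp, Category.assoc]
        _ = _ := by rw [h3, Category.id_comp, Iso.hom_inv_id]
    rwa [h2, FullSubcategory.id_hom, Category.id_comp] at h1
  have hl' : KilledByNonsections (Z := F i) ((b.ι i ≫ e.inv).hom ≫ δ) :=
    fun M f hf => by rw [Category.assoc, hl f hf, comp_zero]
  obtain ⟨Y, f, g, h⟩ := TriExact.exists_isAlmostSplitSequence hi hX (hF i) hl'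
    (hl'.killedByNonretractions hi (hF i))
  exact ⟨Y, F i, f, g, h⟩

variable [C.ContainsZero] [C.IsClosedUnderIsomorphisms]

omit hE in
theorem hasFiniteBiproducts_fullSubcategory : HasFiniteBiproducts C.FullSubcategory := by
  have : C.IsClosedUnderBinaryProducts := .mk' (by
    rintro _ ⟨F, hF⟩
    exact C.prop_of_iso (HasLimit.isoOfNatIso (diagramIsoPair F).symm)
      (C.ext_of_isTriangulatedClosed₂ _ (binaryProductTriangle_distinguished _ _)
        (hF ⟨WalkingPair.left⟩) (hF ⟨WalkingPair.right⟩)))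
  have : C.IsClosedUnderFiniteProducts := .mk'
  exact HasFiniteBiproducts.of_hasFiniteProducts

theorem hasAlmostSplitSequencesOnRight_iff (hKS : IsKrullSchmidt C.FullSubcategory) :
    HasAlmostSplitSequencesOnRight C ↔ ∀ Z : C.FullSubcategory, HasRightDual R Z := by
  refine ⟨fun h Z => ?_, fun h Z hZ hp => ?_⟩
  · have := hasFiniteBiproducts_fullSubcategory (C := C)
    obtain ⟨n, F, b, hF, ⟨hb⟩, ⟨e⟩⟩ := hKS Z
    refine (hasRightDual_of_isBilimit hb fun i => ?_).of_iso e
    by_cases hi : IsExtProjective (F i)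
    · exact hasRightDual_of_isExtProjective hi
    · obtain ⟨X, Y, f, g, hfg⟩ := h (F i) (hF i) hi
      obtain ⟨δ, h0, hl, hr⟩ := hfg.exists_ext
      obtain ⟨θ, hθ⟩ := exists_dual_ne_zero (R := R) h0
      exact ⟨X, θ, isRightDual_of_killed hE hl hr hθ⟩
  · obtain ⟨X, θ, hθ⟩ := h Z
    exact hθ.exists_isAlmostSplitSequence hE hKS hZ hp

theorem hasAlmostSplitSequencesOnLeft_iff (hKS : IsKrullSchmidt C.FullSubcategory) :
    HasAlmostSplitSequencesOnLeft C ↔ ∀ X : C.FullSubcategory, HasLeftDual R X := by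
  refine ⟨fun h X => ?_, fun h X hX hp => ?_⟩
  · have := hasFiniteBiproducts_fullSubcategory (C := C)
    obtain ⟨n, F, b, hF, ⟨hb⟩, ⟨e⟩⟩ := hKS X
    refine (hasLeftDual_of_isBilimit hb fun i => ?_).of_iso e.symm
    by_cases hi : IsExtInjective (F i)
    · exact hasLeftDual_of_isExtInjective hi
    · obtain ⟨Y, Z, f, g, hfg⟩ := h (F i) (hF i) hi
      obtain ⟨δ, h0, hl, hr⟩ := hfg.exists_ext
      obtain ⟨θ, hθ⟩ := exists_dual_ne_zero (R := R) h0
      exact ⟨Z, θ, isLeftDual_of_killed hE hl hr hθ⟩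
  · obtain ⟨Z, θ, hθ⟩ := h X
    exact hθ.exists_isAlmostSplitSequence hE hKS hX hp

end

end DualPairs

end TriExact

/-! ### Shifts and stable categories -/

namespace TriExact

open Pretriangulated ObjectProperty Limits ZeroObject

section

variable {A : Type w} [Category.{v} A] [Preadditive A] [HasShift A ℤ]
  [∀ n : ℤ, (shiftFunctor A n).Additive] {C : ObjectProperty A}

theorem projClass_eq_iff {X Y : C.FullSubcategory} (f g : X ⟶ Y) :
    projClass f = projClass g ↔ ProjTrivial (f - g) :=
  Quotient.functor_map_eq_iff _ _ _

theorem injClass_eq_iff {X Y : C.FullSubcategory} (f g : X ⟶ Y) :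
    injClass f = injClass g ↔ InjTrivial (f - g) :=
  Quotient.functor_map_eq_iff _ _ _

theorem projClass_surjective {X Y : C.FullSubcategory} (g : toProj X ⟶ toProj Y) :
    ∃ f : X ⟶ Y, projClass f = g :=
  (Quotient.functor (projRel C)).map_surjective g

theorem injClass_surjective {X Y : C.FullSubcategory} (g : toInj X ⟶ toInj Y) :
    ∃ f : X ⟶ Y, injClass f = g :=
  (Quotient.functor (injRel C)).map_surjective g

variable [HasZeroObject A] [Pretriangulated A] [C.ContainsZero] [C.IsClosedUnderIsomorphisms]

section Right

variable [C.IsTriangulatedClosed₃]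

theorem prop_shift_one {X : A} (hX : C X) : C (X⟦(1 : ℤ)⟧) :=
  C.ext_of_isTriangulatedClosed₃ _ (rot_of_distTriang _ (contractible_distinguished X)) hX
    (C.prop_of_isZero (isZero_zero A))

/-- The shift `X[1]` as an object of a right triangulated subcategory. -/
def susp (X : C.FullSubcategory) : C.FullSubcategory := ⟨X.obj⟦(1 : ℤ)⟧, prop_shift_one X.property⟩

/-- The shift `f[1]` as a morphism of a right triangulated subcategory. -/
def suspMap {X Y : C.FullSubcategory} (f : X ⟶ Y) : susp X ⟶ susp Y :=
  ⟨f.hom⟦(1 : ℤ)⟧'⟩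

/-- In a right triangulated subcategory the ideal of injectively trivial morphisms is zero, because
the identity of `X[1]` is an extension in `Ext¹(X[1], X)`. -/
theorem InjTrivial.eq_zero {X Y : C.FullSubcategory} {f : X ⟶ Y} (hf : InjTrivial f) : f = 0 := by
  have h : 𝟙 (X.obj⟦(1 : ℤ)⟧) ≫ f.hom⟦(1 : ℤ)⟧' = 0 := hf (susp X) (𝟙 _)
  ext
  apply (shiftFunctor A (1 : ℤ)).map_injective
  rw [Category.id_comp] at h
  exact h.trans (Functor.map_zero _ _ _).symm

theorem injClass_injective {X Y : C.FullSubcategory} {f g : X ⟶ Y} (h : injClass f = injClass g) :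
    f = g :=
  sub_eq_zero.1 ((injClass_eq_iff f g).1 h).eq_zero

theorem ProjTrivial.eq_zero_of_susp {Z X : C.FullSubcategory} {g : Z ⟶ susp X}
    (hg : ProjTrivial g) : g = 0 := by
  have h : g.hom ≫ 𝟙 (X.obj⟦(1 : ℤ)⟧) = 0 := hg X (𝟙 _)
  ext
  exact (Category.comp_id (Y := X.obj⟦(1 : ℤ)⟧) g.hom).symm.trans h

/-- An isomorphism in the injectively stable category of a right triangulated subcategory lifts. -/
theorem nonempty_iso_of_injStable {X Y : InjStable C} (e : X ≅ Y) : Nonempty (X.as ≅ Y.as) := by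
  obtain ⟨f, hf⟩ := injClass_surjective (X := X.as) (Y := Y.as) e.hom
  obtain ⟨g, hg⟩ := injClass_surjective (X := Y.as) (Y := X.as) e.inv
  refine ⟨⟨f, g, injClass_injective ?_, injClass_injective ?_⟩⟩
  · refine (Functor.map_comp _ f g).trans ?_
    exact (congrArg₂ (· ≫ ·) hf hg).trans e.hom_inv_id
  · refine (Functor.map_comp _ g f).trans ?_
    exact (congrArg₂ (· ≫ ·) hg hf).trans e.inv_hom_id

/-- The shift functor on the injectively stable category of a right triangulated subcategory. -/
def injShift (C : ObjectProperty A) [C.ContainsZero] [C.IsClosedUnderIsomorphisms]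
    [C.IsTriangulatedClosed₃] : InjStable C ⥤ InjStable C :=
  CategoryTheory.Quotient.lift (injRel C)
    (C.lift (C.ι ⋙ shiftFunctor A (1 : ℤ)) (fun X => prop_shift_one X.property) ⋙
      Quotient.functor (injRel C))
    (fun X Y f g h => by rw [sub_eq_zero.1 (InjTrivial.eq_zero h)])

instance : (injShift C).Additive where
  map_add {X Y f g} := by
    obtain ⟨f, rfl⟩ := injClass_surjective (X := X.as) (Y := Y.as) f
    obtain ⟨g, rfl⟩ := injClass_surjective (X := X.as) (Y := Y.as) g
    have h : suspMap (f + g) = suspMap f + suspMap g :=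
      hom_ext _ ((shiftFunctor A (1 : ℤ)).map_add (f := f.hom) (g := g.hom))
    exact congrArg injClass h

instance : (injShift C).Faithful where
  map_injective {X Y f g} h := by
    obtain ⟨f, rfl⟩ := injClass_surjective (X := X.as) (Y := Y.as) f
    obtain ⟨g, rfl⟩ := injClass_surjective (X := X.as) (Y := Y.as) g
    have h1 : suspMap f = suspMap g := injClass_injective h
    have h2 : f = g := by
      ext
      exact (shiftFunctor A (1 : ℤ)).map_injective (congrArg (·.hom) h1)
    rw [h2]

instance : (injShift C).Full where
  map_surjective {X Y} f := by
    obtain ⟨f, rfl⟩ := injClass_surjective (X := susp X.as) (Y := susp Y.as) f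
    obtain ⟨g, hg⟩ := (shiftFunctor A (1 : ℤ)).map_surjective (X := X.as.obj) (Y := Y.as.obj) f.hom
    exact ⟨injClass (C.homMk g), congrArg injClass (hom_ext _ hg : suspMap (C.homMk g) = f)⟩

end Right

section Left

variable [C.IsTriangulatedClosed₁]

theorem prop_shift_neg_one {X : A} (hX : C X) : C (X⟦(-1 : ℤ)⟧) :=
  C.ext_of_isTriangulatedClosed₁ _ (inv_rot_of_distTriang _ (inv_rot_of_distTriang _
    (contractible_distinguished X))) (C.prop_of_isZero
      ((shiftFunctor A (-1 : ℤ)).map_isZero (isZero_zero A))) hX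

/-- The shift `X[-1]` as an object of a left triangulated subcategory. -/
def desusp (X : C.FullSubcategory) : C.FullSubcategory :=
  ⟨X.obj⟦(-1 : ℤ)⟧, prop_shift_neg_one X.property⟩

/-- The shift `f[-1]` as a morphism of a left triangulated subcategory. -/
def desuspMap {X Y : C.FullSubcategory} (f : X ⟶ Y) : desusp X ⟶ desusp Y :=
  ⟨f.hom⟦(-1 : ℤ)⟧'⟩

/-- The canonical isomorphism `X[-1][1] ≅ X`. -/
def desuspIso (X : C.FullSubcategory) : (desusp X).obj⟦(1 : ℤ)⟧ ≅ X.obj :=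
  (shiftFunctorCompIsoId A (-1 : ℤ) 1 (by simp)).app X.obj

theorem desuspIso_naturality {X Y : C.FullSubcategory} (f : X ⟶ Y) :
    (f.hom⟦(-1 : ℤ)⟧')⟦(1 : ℤ)⟧' ≫ (desuspIso Y).hom = (desuspIso X).hom ≫ f.hom :=
  (shiftFunctorCompIsoId A (-1 : ℤ) 1 (by simp)).hom.naturality f.hom

/-- In a left triangulated subcategory the ideal of projectively trivial morphisms is zero, because
`Y ≅ Y[-1][1]` is an extension in `Ext¹(Y, Y[-1])`. -/
theorem ProjTrivial.eq_zero {X Y : C.FullSubcategory} {f : X ⟶ Y} (hf : ProjTrivial f) :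
    f = 0 := by
  ext
  exact (cancel_mono (desuspIso Y).inv).1 ((hf (desusp Y) (desuspIso Y).inv).trans zero_comp.symm)

theorem projClass_injective {X Y : C.FullSubcategory} {f g : X ⟶ Y}
    (h : projClass f = projClass g) : f = g :=
  sub_eq_zero.1 ((projClass_eq_iff f g).1 h).eq_zero

theorem InjTrivial.ext_comp_desusp_eq_zero {Z X : C.FullSubcategory} {k : desusp Z ⟶ X}
    (hk : InjTrivial k) : (desuspIso Z).inv ≫ k.hom⟦(1 : ℤ)⟧' = 0 :=
  hk Z (desuspIso Z).inv

/-- An isomorphism in the projectively stable category of a left triangulated subcategory lifts. -/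
theorem nonempty_iso_of_projStable {X Y : ProjStable C} (e : X ≅ Y) : Nonempty (X.as ≅ Y.as) := by
  obtain ⟨f, hf⟩ := projClass_surjective (X := X.as) (Y := Y.as) e.hom
  obtain ⟨g, hg⟩ := projClass_surjective (X := Y.as) (Y := X.as) e.inv
  refine ⟨⟨f, g, projClass_injective ?_, projClass_injective ?_⟩⟩
  · refine (Functor.map_comp _ f g).trans ?_
    exact (congrArg₂ (· ≫ ·) hf hg).trans e.hom_inv_id
  · refine (Functor.map_comp _ g f).trans ?_
    exact (congrArg₂ (· ≫ ·) hg hf).trans e.inv_hom_id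

/-- The inverse shift functor on the projectively stable category of a left triangulated
subcategory. -/
def projShift (C : ObjectProperty A) [C.ContainsZero] [C.IsClosedUnderIsomorphisms]
    [C.IsTriangulatedClosed₁] : ProjStable C ⥤ ProjStable C :=
  CategoryTheory.Quotient.lift (projRel C)
    (C.lift (C.ι ⋙ shiftFunctor A (-1 : ℤ)) (fun X => prop_shift_neg_one X.property) ⋙
      Quotient.functor (projRel C))
    (fun X Y f g h => by rw [sub_eq_zero.1 (ProjTrivial.eq_zero h)])

instance : (projShift C).Additive where
  map_add {X Y f g} := by
    obtain ⟨f, rfl⟩ := projClass_surjective (X := X.as) (Y := Y.as) f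
    obtain ⟨g, rfl⟩ := projClass_surjective (X := X.as) (Y := Y.as) g
    have h : desuspMap (f + g) = desuspMap f + desuspMap g :=
      hom_ext _ ((shiftFunctor A (-1 : ℤ)).map_add (f := f.hom) (g := g.hom))
    exact congrArg projClass h

instance : (projShift C).Faithful where
  map_injective {X Y f g} h := by
    obtain ⟨f, rfl⟩ := projClass_surjective (X := X.as) (Y := Y.as) f
    obtain ⟨g, rfl⟩ := projClass_surjective (X := X.as) (Y := Y.as) g
    have h1 : desuspMap f = desuspMap g := projClass_injective h
    have h2 : f = g := by
      ext
      exact (shiftFunctor A (-1 : ℤ)).map_injective (congrArg (·.hom) h1)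
    rw [h2]

instance : (projShift C).Full where
  map_surjective {X Y} f := by
    obtain ⟨f, rfl⟩ := projClass_surjective (X := desusp X.as) (Y := desusp Y.as) f
    obtain ⟨g, hg⟩ := (shiftFunctor A (-1 : ℤ)).map_surjective (X := X.as.obj) (Y := Y.as.obj)
      f.hom
    exact ⟨projClass (C.homMk g), congrArg projClass (hom_ext _ hg : desuspMap (C.homMk g) = f)⟩

end Left

section Triangulated

variable [C.IsTriangulatedClosed₁] [C.IsTriangulatedClosed₃]

instance : (injShift C).IsEquivalence where
  essSurj := ⟨fun X => ⟨toInj (desusp X.as),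
    ⟨(Quotient.functor (injRel C)).mapIso (C.isoMk (desuspIso X.as))⟩⟩⟩

instance : (projShift C).IsEquivalence where
  essSurj := ⟨fun X => ⟨toProj (susp X.as), ⟨(Quotient.functor (projRel C)).mapIso
    (C.isoMk ((shiftFunctorCompIsoId A (1 : ℤ) (-1) (by simp)).app X.as.obj))⟩⟩⟩

end Triangulated

end

section Linear

variable (R : Type u) [CommRing R] {A : Type w} [Category.{v} A] [Preadditive A] [Linear R A]
  [HasShift A ℤ] [∀ n : ℤ, (shiftFunctor A n).Additive] [∀ n : ℤ, (shiftFunctor A n).Linear R]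
  {C : ObjectProperty A}
  [HasZeroObject A] [Pretriangulated A] [C.ContainsZero] [C.IsClosedUnderIsomorphisms]

/-- Extensions `Ext¹(Y, X)` as morphisms `Y ⟶ X[1]` in a right triangulated subcategory. -/
def suspEquiv [C.IsTriangulatedClosed₃] (Y X : C.FullSubcategory) :
    (Y ⟶ susp X) ≃ₗ[R] Ext1 Y X :=
  InducedCategory.homLinearEquiv

/-- Extensions `Ext¹(Z, X)` as morphisms `Z[-1] ⟶ X` in a left triangulated subcategory. -/
noncomputable def desuspEquiv [C.IsTriangulatedClosed₁] (Z X : C.FullSubcategory) :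
    (desusp Z ⟶ X) ≃ₗ[R] Ext1 Z X :=
  LinearEquiv.ofBijective
    (Linear.leftComp R _ (desuspIso Z).inv ∘ₗ (shiftFunctor A (1 : ℤ)).mapLinearMap R ∘ₗ
      (InducedCategory.homLinearEquiv (R := R) (X := desusp Z) (Y := X)).toLinearMap) (by
    constructor
    · intro f g h
      ext
      exact (shiftFunctor A (1 : ℤ)).map_injective ((cancel_epi (desuspIso Z).inv).1 h)
    · intro ζ
      obtain ⟨f, hf⟩ := (shiftFunctor A (1 : ℤ)).map_surjective
        (X := (desusp Z).obj) (Y := X.obj) ((desuspIso Z).hom ≫ ζ)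
      refine ⟨C.homMk f, ?_⟩
      change (desuspIso Z).inv ≫ f⟦(1 : ℤ)⟧' = ζ
      rw [hf, Iso.inv_hom_id_assoc])

theorem desuspEquiv_apply [C.IsTriangulatedClosed₁] {Z X : C.FullSubcategory}
    (k : desusp Z ⟶ X) : desuspEquiv R Z X k = (desuspIso Z).inv ≫ k.hom⟦(1 : ℤ)⟧' := rfl

/-- In a right triangulated subcategory the injectively stable morphisms are the morphisms. -/
noncomputable def injClassEquiv [C.IsTriangulatedClosed₃] (X Y : C.FullSubcategory) :
    (X ⟶ Y) ≃ₗ[R] (toInj X ⟶ toInj Y) :=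
  LinearEquiv.ofBijective ((Quotient.functor (injRel C)).mapLinearMap R)
    ⟨fun _ _ h => injClass_injective h, injClass_surjective⟩

/-- In a left triangulated subcategory the projectively stable morphisms are the morphisms. -/
noncomputable def projClassEquiv [C.IsTriangulatedClosed₁] (X Y : C.FullSubcategory) :
    (X ⟶ Y) ≃ₗ[R] (toProj X ⟶ toProj Y) :=
  LinearEquiv.ofBijective ((Quotient.functor (projRel C)).mapLinearMap R)
    ⟨fun _ _ h => projClass_injective h, projClass_surjective⟩

variable {R}

theorem HomReflexive.ext_of_right [C.IsTriangulatedClosed₃] (hC : HomReflexive R C)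
    (X Y : C.FullSubcategory) : IsIReflexive R (Ext1 X Y) :=
  (hC X (susp Y)).of_equiv (suspEquiv R X Y)

theorem HomReflexive.ext_of_left [C.IsTriangulatedClosed₁] (hC : HomReflexive R C)
    (X Y : C.FullSubcategory) : IsIReflexive R (Ext1 X Y) :=
  (hC (desusp X) Y).of_equiv (desuspEquiv R X Y)

/-! ### Symmetry and uniqueness of dual pairs -/

section Right

variable [C.IsTriangulatedClosed₃]

theorem IsRightDual.ext_eq_zero {Z X Y : C.FullSubcategory} {θ : IDual R (Ext1 Z X)}
    (hθ : IsRightDual θ) {ζ : Ext1 Y X} (h : ∀ g : Z ⟶ Y, θ (g.hom ≫ ζ) = 0) : ζ = 0 :=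
  eq_zero_of_pairing_eq_zero (rightPairing θ Y) (hθ.surjective Y) h

theorem IsRightDual.hom_ext {Z X X' : C.FullSubcategory} {θ : IDual R (Ext1 Z X)}
    (hθ : IsRightDual θ) {u u' : X' ⟶ X}
    (h : ∀ η : Ext1 Z X', θ (η ≫ u.hom⟦(1 : ℤ)⟧') = θ (η ≫ u'.hom⟦(1 : ℤ)⟧')) : u = u' := by
  ext
  apply (shiftFunctor A (1 : ℤ)).map_injective
  rw [← sub_eq_zero]
  refine hθ.ext_eq_zero (Y := susp X') fun g => ?_
  have h1 : θ (g.hom ≫ u.hom⟦(1 : ℤ)⟧') = θ (g.hom ≫ u'.hom⟦(1 : ℤ)⟧') := h g.hom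
  have h2 : g.hom ≫ (u.hom⟦(1 : ℤ)⟧' - u'.hom⟦(1 : ℤ)⟧') =
    g.hom ≫ u.hom⟦(1 : ℤ)⟧' - g.hom ≫ u'.hom⟦(1 : ℤ)⟧' := Preadditive.comp_sub ..
  exact (congrArg θ h2).trans (by rw [map_sub, h1, sub_self])

/-- Functionals on `Ext¹(Z, X')` are represented by morphisms `X' ⟶ X`: they are functionals on
`Hom(Z, X'[1])`, where no nonzero morphism is projectively trivial. -/
theorem IsRightDual.exists_hom (hE : ∀ X Y : C.FullSubcategory, IsIReflexive R (Ext1 X Y))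
    {Z X X' : C.FullSubcategory} {θ : IDual R (Ext1 Z X)} (hθ : IsRightDual θ)
    (l : IDual R (Ext1 Z X')) :
    ∃ u : X' ⟶ X, ∀ η : Ext1 Z X', l η = θ (η ≫ u.hom⟦(1 : ℤ)⟧') := by
  obtain ⟨e, he⟩ := exists_eq_pairing (hE _ _) (rightPairing θ (susp X')) (hθ.surjective _)
    (l ∘ₗ (suspEquiv R Z X').toLinearMap)
    (fun g hg => by rw [(hθ.projTrivial g hg).eq_zero_of_susp, map_zero])
  obtain ⟨u, hu⟩ := (shiftFunctor A (1 : ℤ)).map_surjective (X := X'.obj) (Y := X.obj) e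
  refine ⟨C.homMk u, fun η => ?_⟩
  rw [homMk_hom, hu]
  exact he (C.homMk η)

/-- In a right triangulated subcategory a right dual pair is a left dual pair. -/
theorem IsRightDual.isLeftDual (hE : ∀ X Y : C.FullSubcategory, IsIReflexive R (Ext1 X Y))
    {Z X : C.FullSubcategory} {θ : IDual R (Ext1 Z X)} (hθ : IsRightDual θ) : IsLeftDual θ where
  injTrivial {W} f hf := by
    have : f = 0 := hθ.hom_ext fun η => by
      refine (LinearMap.congr_fun hf η).trans ?_
      rw [show (0 : W ⟶ X).hom = 0 from rfl, Functor.map_zero, comp_zero, map_zero]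
      rfl
    intro M δ
    rw [this, show (0 : W ⟶ X).hom = 0 from rfl, Functor.map_zero, comp_zero]
  surjective W l := by
    obtain ⟨u, hu⟩ := hθ.exists_hom hE l
    exact ⟨u, LinearMap.ext fun η => (hu η).symm⟩

theorem IsRightDual.nonempty_iso (hE : ∀ X Y : C.FullSubcategory, IsIReflexive R (Ext1 X Y))
    {Z X X' : C.FullSubcategory} {θ : IDual R (Ext1 Z X)} {θ' : IDual R (Ext1 Z X')}
    (hθ : IsRightDual θ) (hθ' : IsRightDual θ') : Nonempty (X ≅ X') := by
  obtain ⟨u, hu⟩ := hθ.exists_hom hE θ'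
  obtain ⟨u', hu'⟩ := hθ'.exists_hom hE θ
  refine ⟨⟨u', u, hθ.hom_ext fun η => ?_, hθ'.hom_ext fun η => ?_⟩⟩
  · rw [FullSubcategory.comp_hom, Functor.map_comp, ← Category.assoc, ← hu, ← hu']
    simp
  · rw [FullSubcategory.comp_hom, Functor.map_comp, ← Category.assoc, ← hu', ← hu]
    simp

end Right

section Left

variable [C.IsTriangulatedClosed₁]

theorem IsLeftDual.ext_eq_zero {Z X W : C.FullSubcategory} {θ : IDual R (Ext1 Z X)}
    (hθ : IsLeftDual θ) {ζ : Ext1 Z W} (h : ∀ f : W ⟶ X, θ (ζ ≫ f.hom⟦(1 : ℤ)⟧') = 0) : ζ = 0 :=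
  eq_zero_of_pairing_eq_zero (leftPairing θ W) (hθ.surjective W) h

theorem IsLeftDual.hom_ext {Z Z' X : C.FullSubcategory} {θ : IDual R (Ext1 Z X)}
    (hθ : IsLeftDual θ) {v v' : Z ⟶ Z'}
    (h : ∀ η : Ext1 Z' X, θ (v.hom ≫ η) = θ (v'.hom ≫ η)) : v = v' := by
  ext
  rw [← cancel_mono (desuspIso Z').inv, ← sub_eq_zero]
  refine hθ.ext_eq_zero (W := desusp Z') fun f => ?_
  rw [Preadditive.sub_comp, map_sub, Category.assoc, Category.assoc, h, sub_self]

/-- Functionals on `Ext¹(Z', X)` are represented by morphisms `Z ⟶ Z'`: they are functionals on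
`Hom(Z'[-1], X)`, where no nonzero morphism is injectively trivial. -/
theorem IsLeftDual.exists_hom (hE : ∀ X Y : C.FullSubcategory, IsIReflexive R (Ext1 X Y))
    {Z Z' X : C.FullSubcategory} {θ : IDual R (Ext1 Z X)} (hθ : IsLeftDual θ)
    (l : IDual R (Ext1 Z' X)) :
    ∃ v : Z ⟶ Z', ∀ η : Ext1 Z' X, l η = θ (v.hom ≫ η) := by
  obtain ⟨e, he⟩ := exists_eq_pairing (hE _ _) (leftPairing θ (desusp Z')) (hθ.surjective _)
    (l ∘ₗ (desuspEquiv R Z' X).toLinearMap)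
    (fun k hk => by
      change l ((desuspIso Z').inv ≫ k.hom⟦(1 : ℤ)⟧') = 0
      rw [(hθ.injTrivial k hk).ext_comp_desusp_eq_zero, map_zero])
  refine ⟨C.homMk (e ≫ (desuspIso Z').hom), fun η => ?_⟩
  obtain ⟨k, rfl⟩ := (desuspEquiv R Z' X).surjective η
  refine (he k).trans ?_
  rw [leftPairing_apply, homMk_hom, desuspEquiv_apply, Category.assoc, Iso.hom_inv_id_assoc]

/-- In a left triangulated subcategory a left dual pair is a right dual pair. -/
theorem IsLeftDual.isRightDual (hE : ∀ X Y : C.FullSubcategory, IsIReflexive R (Ext1 X Y))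
    {Z X : C.FullSubcategory} {θ : IDual R (Ext1 Z X)} (hθ : IsLeftDual θ) : IsRightDual θ where
  projTrivial {Y} g hg := by
    have : g = 0 := hθ.hom_ext fun η => by
      refine (LinearMap.congr_fun hg η).trans ?_
      rw [show (0 : Z ⟶ Y).hom = 0 from rfl, zero_comp, map_zero]
      rfl
    intro M δ
    rw [this, show (0 : Z ⟶ Y).hom = 0 from rfl, zero_comp]
  surjective Y l := by
    obtain ⟨v, hv⟩ := hθ.exists_hom hE l
    exact ⟨v, LinearMap.ext fun η => (hv η).symm⟩

theorem IsLeftDual.nonempty_iso (hE : ∀ X Y : C.FullSubcategory, IsIReflexive R (Ext1 X Y))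
    {Z Z' X : C.FullSubcategory} {θ : IDual R (Ext1 Z X)} {θ' : IDual R (Ext1 Z' X)}
    (hθ : IsLeftDual θ) (hθ' : IsLeftDual θ') : Nonempty (Z ≅ Z') := by
  obtain ⟨v, hv⟩ := hθ.exists_hom hE θ'
  obtain ⟨v', hv'⟩ := hθ'.exists_hom hE θ
  refine ⟨⟨v, v', hθ.hom_ext fun η => ?_, hθ'.hom_ext fun η => ?_⟩⟩
  · rw [FullSubcategory.comp_hom, Category.assoc, ← hv, ← hv']
    simp
  · rw [FullSubcategory.comp_hom, Category.assoc, ← hv', ← hv]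
    simp

end Left

end Linear

end TriExact

namespace TriExact

open Pretriangulated ObjectProperty Limits ZeroObject

variable {R : Type u} [CommRing R] {A : Type w} [Category.{v} A] [Preadditive A] [Linear R A]
  [HasShift A ℤ] [∀ n : ℤ, (shiftFunctor A n).Additive] [∀ n : ℤ, (shiftFunctor A n).Linear R]
  {C : ObjectProperty A}

/-! ### Auslander-Reiten functors and dual pairs -/

theorem RightARFunctor.isRightDual (F : RightARFunctor R C) (Z : C.FullSubcategory) :
    IsRightDual (X := (F.τ.obj (toProj Z)).as) (F.iso Z Z (𝟙 _)) := by
  have key : ∀ {Y : C.FullSubcategory} (g : Z ⟶ Y),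
      rightPairing (X := (F.τ.obj (toProj Z)).as) (F.iso Z Z (𝟙 _)) Y g =
        F.iso Z Y (projClass g) := fun g => LinearMap.ext fun ζ => by
    have h := F.naturality_right (𝟙 (toProj Z)) g ζ
    rw [Category.id_comp] at h
    exact h.symm
  refine ⟨fun g hg => ?_, fun Y l => ?_⟩
  · rw [key, LinearEquiv.map_eq_zero_iff] at hg
    have := (projClass_eq_iff g 0).1 (hg.trans (Functor.map_zero _ _ _).symm)
    rwa [sub_zero] at this
  · obtain ⟨g, hg⟩ := projClass_surjective ((F.iso Z Y).symm l)
    exact ⟨g, by rw [key, hg, LinearEquiv.apply_symm_apply]⟩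

theorem LeftARFunctor.isLeftDual (F : LeftARFunctor R C) (X : C.FullSubcategory) :
    IsLeftDual (Z := (F.τ.obj (toInj X)).as) (F.iso X X (𝟙 _)) := by
  have key : ∀ {W : C.FullSubcategory} (f : W ⟶ X),
      leftPairing (Z := (F.τ.obj (toInj X)).as) (F.iso X X (𝟙 _)) W f =
        F.iso W X (injClass f) := fun f => LinearMap.ext fun ζ => by
    have h := F.naturality_left f (𝟙 (toInj X)) ζ
    rw [Category.comp_id] at h
    exact h.symm
  refine ⟨fun f hf => ?_, fun W l => ?_⟩
  · rw [key, LinearEquiv.map_eq_zero_iff] at hf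
    have := (injClass_eq_iff f 0).1 (hf.trans (Functor.map_zero _ _ _).symm)
    rwa [sub_zero] at this
  · obtain ⟨f, hf⟩ := injClass_surjective ((F.iso W X).symm l)
    exact ⟨f, by rw [key, hf, LinearEquiv.apply_symm_apply]⟩

variable [HasZeroObject A] [Pretriangulated A] [C.ContainsZero] [C.IsClosedUnderIsomorphisms]

section Right

variable [C.IsTriangulatedClosed₃]
  (hE : ∀ X Y : C.FullSubcategory, IsIReflexive R (Ext1 X Y))
  {G : C.FullSubcategory → C.FullSubcategory} {θ : ∀ Z, IDual R (Ext1 Z (G Z))}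
  (hθ : ∀ Z, IsRightDual (θ Z))

include hE hθ in
theorem exists_rightMap {Z Z' : C.FullSubcategory} (f : Z ⟶ Z') :
    ∃ u : G Z ⟶ G Z', ∀ η : Ext1 Z' (G Z), θ Z (f.hom ≫ η) = θ Z' (η ≫ u.hom⟦(1 : ℤ)⟧') :=
  (hθ Z').exists_hom hE (θ Z ∘ₗ Linear.leftComp R _ f.hom)

/-- The morphism `G Z ⟶ G Z'` that is adjoint to `f : Z ⟶ Z'` with respect to the functionals of
right dual pairs. -/
noncomputable def rightMap {Z Z' : C.FullSubcategory} (f : Z ⟶ Z') : G Z ⟶ G Z' :=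
  (exists_rightMap hE hθ f).choose

theorem rightMap_spec {Z Z' : C.FullSubcategory} (f : Z ⟶ Z') (η : Ext1 Z' (G Z)) :
    θ Z (f.hom ≫ η) = θ Z' (η ≫ (rightMap hE hθ f).hom⟦(1 : ℤ)⟧') :=
  (exists_rightMap hE hθ f).choose_spec η

theorem rightMap_eq {Z Z' : C.FullSubcategory} {f : Z ⟶ Z'} {u : G Z ⟶ G Z'}
    (h : ∀ η : Ext1 Z' (G Z), θ Z (f.hom ≫ η) = θ Z' (η ≫ u.hom⟦(1 : ℤ)⟧')) :
    rightMap hE hθ f = u :=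
  (hθ Z').hom_ext fun η => by rw [← rightMap_spec, h]

/-- The functor from the projectively stable to the injectively stable category given on objects by
a choice of right dual pairs. -/
noncomputable def rightFunctor : ProjStable C ⥤ InjStable C :=
  CategoryTheory.Quotient.lift (projRel C)
    { obj := fun Z => toInj (G Z)
      map := fun f => injClass (rightMap hE hθ f)
      map_id := fun Z => by
        rw [rightMap_eq hE hθ (u := 𝟙 (G Z))]
        · exact CategoryTheory.Functor.map_id _ _
        · intro η
          rw [FullSubcategory.id_hom, FullSubcategory.id_hom, CategoryTheory.Functor.map_id,
            Category.id_comp, Category.comp_id]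
      map_comp := fun {Z Z' Z''} f g => by
        rw [rightMap_eq hE hθ (u := rightMap hE hθ f ≫ rightMap hE hθ g)]
        · exact Functor.map_comp _ _ _
        · intro η
          rw [FullSubcategory.comp_hom, Category.assoc, rightMap_spec, FullSubcategory.comp_hom,
            Functor.map_comp, Category.assoc, ← Category.assoc η, rightMap_spec] }
    (fun Z Z' f g h => by
      refine congrArg injClass (rightMap_eq hE hθ fun η => ?_)
      rw [← rightMap_spec, (projRel_iff f g).1 h])

instance : (rightFunctor hE hθ).Additive where
  map_add {Z Z' f g} := by
    obtain ⟨f, rfl⟩ := projClass_surjective (X := Z.as) (Y := Z'.as) f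
    obtain ⟨g, rfl⟩ := projClass_surjective (X := Z.as) (Y := Z'.as) g
    refine congrArg injClass (rightMap_eq hE hθ (f := f + g)
      (u := rightMap hE hθ f + rightMap hE hθ g) fun η => ?_)
    change θ _ ((f.hom + g.hom) ≫ η) =
      θ _ (η ≫ ((rightMap hE hθ f).hom + (rightMap hE hθ g).hom)⟦(1 : ℤ)⟧')
    rw [Functor.map_add, Preadditive.add_comp, Preadditive.comp_add, map_add, map_add,
      rightMap_spec, rightMap_spec]

instance : (rightFunctor hE hθ).Faithful where
  map_injective {Z Z' f g} h := by
    obtain ⟨f, rfl⟩ := projClass_surjective (X := Z.as) (Y := Z'.as) f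
    obtain ⟨g, rfl⟩ := projClass_surjective (X := Z.as) (Y := Z'.as) g
    have h1 : rightMap hE hθ f = rightMap hE hθ g := injClass_injective h
    refine (projClass_eq_iff f g).2 ((hθ Z.as).projTrivial _ ?_)
    rw [map_sub, sub_eq_zero]
    ext η
    rw [rightPairing_apply, rightPairing_apply, rightMap_spec hE hθ, h1, rightMap_spec hE hθ]

instance : (rightFunctor hE hθ).Full where
  map_surjective {Z Z'} u := by
    obtain ⟨u, rfl⟩ := injClass_surjective (X := G Z.as) (Y := G Z'.as) u
    obtain ⟨f, hf⟩ := (hθ Z.as).surjective Z'.as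
      (θ Z'.as ∘ₗ Linear.rightComp R _ (u.hom⟦(1 : ℤ)⟧'))
    exact ⟨projClass f, congrArg injClass (rightMap_eq hE hθ fun η => LinearMap.congr_fun hf η)⟩

include hE hθ in
theorem exists_rightARFunctor : ∃ F : RightARFunctor R C, F.τ = rightFunctor hE hθ := by
  have key : ∀ Z Y : C.FullSubcategory, ∃ e : (toProj Z ⟶ toProj Y) ≃ₗ[R] IDual R (Ext1 Y (G Z)),
      ∀ g : Z ⟶ Y, e (projClass g) = rightPairing (θ Z) Y g := fun Z Y => by
    refine LinearEquiv.exists_of_ker_eq ((Quotient.functor (projRel C)).mapLinearMap R)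
      (rightPairing (θ Z) Y) projClass_surjective ((hθ Z).surjective Y) fun g => ?_
    refine ⟨fun h => ?_, fun h => ?_⟩
    · have := (projClass_eq_iff g 0).1 (h.trans (Functor.map_zero _ _ _).symm)
      rw [sub_zero] at this
      exact rightPairing_eq_zero_of_projTrivial _ this
    · refine ((projClass_eq_iff g 0).2 ?_).trans (Functor.map_zero _ _ _)
      rw [sub_zero]
      exact (hθ Z).projTrivial g h
  choose e he using key
  refine ⟨⟨rightFunctor hE hθ, inferInstance, e, ?_, ?_⟩, rfl⟩
  · intro X X' Y f g (ζ : Ext1 Y (G X))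
    obtain ⟨g, rfl⟩ := projClass_surjective g
    have h1 : e X Y (projClass f ≫ projClass g) ζ = θ X (f.hom ≫ g.hom ≫ ζ) := by
      rw [← Functor.map_comp, he, rightPairing_apply, FullSubcategory.comp_hom, Category.assoc]
    have h2 : e X' Y (projClass g) (ζ ≫ (rightMap hE hθ f).hom⟦(1 : ℤ)⟧') =
        θ X (f.hom ≫ g.hom ≫ ζ) := by
      rw [he, rightPairing_apply, rightMap_spec hE hθ f (g.hom ≫ ζ), Category.assoc]
    exact h1.trans h2.symm
  · intro X Y Y' g h (ζ : Ext1 Y' (G X))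
    obtain ⟨g, rfl⟩ := projClass_surjective g
    have h1 : e X Y' (projClass g ≫ projClass h) ζ = e X Y (projClass g) (h.hom ≫ ζ) := by
      rw [← Functor.map_comp, he, he, rightPairing_apply, rightPairing_apply,
        FullSubcategory.comp_hom, Category.assoc]
    exact h1

include hE in
theorem nonempty_rightARFunctor_iff :
    Nonempty (RightARFunctor R C) ↔ ∀ Z : C.FullSubcategory, HasRightDual R Z := by
  refine ⟨fun ⟨F⟩ Z => ⟨_, _, F.isRightDual Z⟩, fun h => ?_⟩
  choose G θ hθ using h
  obtain ⟨F, -⟩ := exists_rightARFunctor hE hθ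
  exact ⟨F⟩

/-! ### Right Serre functors -/

/-- In a right triangulated subcategory `Ext¹(Y, X)` is the module of injectively stable morphisms
from `Y` to `X[1]`. -/
noncomputable def extInjEquiv (Y X : C.FullSubcategory) :
    Ext1 Y X ≃ₗ[R] (toInj Y ⟶ toInj (susp X)) :=
  (suspEquiv R Y X).symm ≪≫ₗ injClassEquiv R Y (susp X)

theorem extInjEquiv_symm_injClass {Y X : C.FullSubcategory} (f : Y ⟶ susp X) :
    (extInjEquiv (R := R) Y X).symm (injClass f) = f.hom := by
  exact (LinearEquiv.symm_apply_eq _).2 rfl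

/-- The shift of a right Auslander-Reiten functor is a right Serre functor. -/
theorem RightARFunctor.exists_rightSerreFunctor (F : RightARFunctor R C) :
    ∃ S : RightSerreFunctor R C, S.S = F.τ ⋙ injShift C := by
  have := F.additive
  refine ⟨⟨F.τ ⋙ injShift C, inferInstance, fun X Y => F.iso X Y ≪≫ₗ
    LinearEquiv.arrowCongr (extInjEquiv Y (F.τ.obj (toProj X)).as) (LinearEquiv.refl R _),
    ?_, ?_⟩, rfl⟩
  · intro X X' Y f g u
    obtain ⟨u, rfl⟩ := injClass_surjective (Y := susp (F.τ.obj (toProj X)).as) u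
    obtain ⟨t, ht⟩ := injClass_surjective (X := (F.τ.obj (toProj X)).as)
      (Y := (F.τ.obj (toProj X')).as) (F.τ.map (projClass f))
    have h := F.naturality_left f g u.hom
    rw [← ht] at h
    have h1 : injClass u ≫ (F.τ ⋙ injShift C).map (projClass f) = injClass (u ≫ suspMap t) := by
      refine Eq.trans ?_ (Functor.map_comp _ u (suspMap t)).symm
      rw [Functor.comp_map, ← ht]
      rfl
    change F.iso X Y (projClass f ≫ g) ((extInjEquiv _ _).symm (injClass u)) =
      F.iso X' Y g ((extInjEquiv _ _).symm _)
    refine (congrArg _ (extInjEquiv_symm_injClass u)).trans (h.trans (congrArg _ ?_))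
    exact ((congrArg _ h1).trans (extInjEquiv_symm_injClass (u ≫ suspMap t))).symm
  · intro X Y Y' g h u
    obtain ⟨u, rfl⟩ := injClass_surjective (Y := susp (F.τ.obj (toProj X)).as) u
    change F.iso X Y' (g ≫ projClass h) ((extInjEquiv _ _).symm (injClass u)) =
      F.iso X Y g ((extInjEquiv _ _).symm _)
    have h1 : injClass h ≫ injClass u = injClass (h ≫ u) := (Functor.map_comp _ h u).symm
    refine (congrArg _ (extInjEquiv_symm_injClass u)).trans
      ((F.naturality_right g h u.hom).trans (congrArg _ ?_))
    exact ((congrArg _ h1).trans (extInjEquiv_symm_injClass (h ≫ u))).symm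

/-- If `X[1]` is isomorphic to the value of a right Serre functor at `Z`, then `Z` and `X` form a
right dual pair. -/
theorem RightSerreFunctor.exists_isRightDual (F : RightSerreFunctor R C) {Z X : C.FullSubcategory}
    (e : susp X ≅ (F.S.obj (toProj Z)).as) : ∃ θ : IDual R (Ext1 Z X), IsRightDual θ := by
  let s : ∀ Y : C.FullSubcategory, Ext1 Y X ≃ₗ[R] (toInj Y ⟶ F.S.obj (toProj Z)) := fun Y =>
    extInjEquiv Y X ≪≫ₗ LinearEquiv.ofLinearMap
      (Linear.rightComp R _ (injClass e.hom)) (Linear.rightComp R _ (injClass e.inv))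
      (by ext f
          change (f ≫ injClass e.inv) ≫ injClass e.hom = f
          rw [Category.assoc, ← Functor.map_comp, Iso.inv_hom_id, CategoryTheory.Functor.map_id]
          exact Category.comp_id _)
      (by ext f
          change (f ≫ injClass e.hom) ≫ injClass e.inv = f
          rw [Category.assoc, ← Functor.map_comp, Iso.hom_inv_id, CategoryTheory.Functor.map_id]
          exact Category.comp_id _)
  have hs : ∀ {Y Y' : C.FullSubcategory} (g : Y ⟶ Y') (ζ : Ext1 Y' X),
      s Y (g.hom ≫ ζ) = injClass g ≫ s Y' ζ := fun {Y Y'} g ζ => by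
    change injClass (g ≫ (⟨ζ⟩ : Y' ⟶ susp X)) ≫ injClass e.hom =
      injClass g ≫ injClass (⟨ζ⟩ : Y' ⟶ susp X) ≫ injClass e.hom
    rw [injClass, Functor.map_comp, Category.assoc]
  have key : ∀ {Y : C.FullSubcategory} (g : Z ⟶ Y),
      rightPairing (F.iso Z Z (𝟙 _) ∘ₗ (s Z).toLinearMap) Y g =
        F.iso Z Y (projClass g) ∘ₗ (s Y).toLinearMap := fun {Y} g => LinearMap.ext fun ζ => by
    have h := F.naturality_right (𝟙 (toProj Z)) g (s Y ζ)
    rw [Category.id_comp, ← hs] at h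
    exact h.symm
  refine ⟨F.iso Z Z (𝟙 _) ∘ₗ (s Z).toLinearMap, fun {Y} g hg => ?_, fun Y l => ?_⟩
  · have h0 : F.iso Z Y (projClass g) = 0 := LinearMap.ext fun u => by
      have h := LinearMap.congr_fun hg ((s Y).symm u)
      rw [key] at h
      simpa using h
    rw [LinearEquiv.map_eq_zero_iff] at h0
    have := (projClass_eq_iff g 0).1 (h0.trans (Functor.map_zero _ _ _).symm)
    rwa [sub_zero] at this
  · obtain ⟨g, hg⟩ := projClass_surjective ((F.iso Z Y).symm (l ∘ₗ (s Y).symm.toLinearMap))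
    refine ⟨g, ?_⟩
    rw [key, hg, LinearEquiv.apply_symm_apply]
    ext ζ
    simp

end Right

section Left

variable [C.IsTriangulatedClosed₁]
  (hE : ∀ X Y : C.FullSubcategory, IsIReflexive R (Ext1 X Y))
  {G : C.FullSubcategory → C.FullSubcategory} {θ : ∀ X, IDual R (Ext1 (G X) X)}
  (hθ : ∀ X, IsLeftDual (θ X))

include hE hθ in
theorem exists_leftMap {X X' : C.FullSubcategory} (f : X ⟶ X') :
    ∃ v : G X ⟶ G X', ∀ η : Ext1 (G X') X, θ X' (η ≫ f.hom⟦(1 : ℤ)⟧') = θ X (v.hom ≫ η) :=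
  (hθ X).exists_hom hE (θ X' ∘ₗ Linear.rightComp R _ (f.hom⟦(1 : ℤ)⟧'))

/-- The morphism `G X ⟶ G X'` that is adjoint to `f : X ⟶ X'` with respect to the functionals of
left dual pairs. -/
noncomputable def leftMap {X X' : C.FullSubcategory} (f : X ⟶ X') : G X ⟶ G X' :=
  (exists_leftMap hE hθ f).choose

theorem leftMap_spec {X X' : C.FullSubcategory} (f : X ⟶ X') (η : Ext1 (G X') X) :
    θ X' (η ≫ f.hom⟦(1 : ℤ)⟧') = θ X ((leftMap hE hθ f).hom ≫ η) :=
  (exists_leftMap hE hθ f).choose_spec η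

theorem leftMap_eq {X X' : C.FullSubcategory} {f : X ⟶ X'} {v : G X ⟶ G X'}
    (h : ∀ η : Ext1 (G X') X, θ X' (η ≫ f.hom⟦(1 : ℤ)⟧') = θ X (v.hom ≫ η)) :
    leftMap hE hθ f = v :=
  (hθ X).hom_ext fun η => by rw [← leftMap_spec, h]

/-- The functor from the injectively stable to the projectively stable category given on objects by
a choice of left dual pairs. -/
noncomputable def leftFunctor : InjStable C ⥤ ProjStable C :=
  CategoryTheory.Quotient.lift (injRel C)
    { obj := fun X => toProj (G X)
      map := fun f => projClass (leftMap hE hθ f)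
      map_id := fun X => by
        rw [leftMap_eq hE hθ (v := 𝟙 (G X))]
        · exact CategoryTheory.Functor.map_id _ _
        · intro η
          rw [FullSubcategory.id_hom, FullSubcategory.id_hom, CategoryTheory.Functor.map_id,
            Category.id_comp, Category.comp_id]
      map_comp := fun {X X' X''} f g => by
        rw [leftMap_eq hE hθ (v := leftMap hE hθ f ≫ leftMap hE hθ g)]
        · exact Functor.map_comp _ _ _
        · intro η
          rw [FullSubcategory.comp_hom, Functor.map_comp, ← Category.assoc, leftMap_spec,
            FullSubcategory.comp_hom, ← Category.assoc, leftMap_spec, Category.assoc] }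
    (fun X X' f g h => by
      refine congrArg projClass (leftMap_eq hE hθ fun η => ?_)
      rw [← leftMap_spec, (injRel_iff f g).1 h])

instance : (leftFunctor hE hθ).Additive where
  map_add {X X' f g} := by
    obtain ⟨f, rfl⟩ := injClass_surjective (X := X.as) (Y := X'.as) f
    obtain ⟨g, rfl⟩ := injClass_surjective (X := X.as) (Y := X'.as) g
    refine congrArg projClass (leftMap_eq hE hθ (f := f + g)
      (v := leftMap hE hθ f + leftMap hE hθ g) fun η => ?_)
    change θ _ (η ≫ (f.hom + g.hom)⟦(1 : ℤ)⟧') =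
      θ _ (((leftMap hE hθ f).hom + (leftMap hE hθ g).hom) ≫ η)
    rw [Functor.map_add, Preadditive.add_comp, Preadditive.comp_add, map_add, map_add,
      leftMap_spec, leftMap_spec]

instance : (leftFunctor hE hθ).Faithful where
  map_injective {X X' f g} h := by
    obtain ⟨f, rfl⟩ := injClass_surjective (X := X.as) (Y := X'.as) f
    obtain ⟨g, rfl⟩ := injClass_surjective (X := X.as) (Y := X'.as) g
    have h1 : leftMap hE hθ f = leftMap hE hθ g := projClass_injective h
    refine (injClass_eq_iff f g).2 ((hθ X'.as).injTrivial _ ?_)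
    rw [map_sub, sub_eq_zero]
    ext η
    rw [leftPairing_apply, leftPairing_apply, leftMap_spec hE hθ, h1, leftMap_spec hE hθ]

instance : (leftFunctor hE hθ).Full where
  map_surjective {X X'} v := by
    obtain ⟨v, rfl⟩ := projClass_surjective (X := G X.as) (Y := G X'.as) v
    obtain ⟨f, hf⟩ := (hθ X'.as).surjective X.as
      (θ X.as ∘ₗ Linear.leftComp R _ v.hom)
    exact ⟨injClass f, congrArg projClass (leftMap_eq hE hθ fun η => LinearMap.congr_fun hf η)⟩

include hE hθ in
theorem exists_leftARFunctor : ∃ F : LeftARFunctor R C, F.τ = leftFunctor hE hθ := by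
  have key : ∀ X Y : C.FullSubcategory, ∃ e : (toInj X ⟶ toInj Y) ≃ₗ[R] IDual R (Ext1 (G Y) X),
      ∀ f : X ⟶ Y, e (injClass f) = leftPairing (θ Y) X f := fun X Y => by
    refine LinearEquiv.exists_of_ker_eq ((Quotient.functor (injRel C)).mapLinearMap R)
      (leftPairing (θ Y) X) injClass_surjective ((hθ Y).surjective X) fun f => ?_
    refine ⟨fun h => ?_, fun h => ?_⟩
    · have := (injClass_eq_iff f 0).1 (h.trans (Functor.map_zero _ _ _).symm)
      rw [sub_zero] at this
      exact leftPairing_eq_zero_of_injTrivial _ this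
    · refine ((injClass_eq_iff f 0).2 ?_).trans (Functor.map_zero _ _ _)
      rw [sub_zero]
      exact (hθ Y).injTrivial f h
  choose e he using key
  refine ⟨⟨leftFunctor hE hθ, inferInstance, e, ?_, ?_⟩, rfl⟩
  · intro X X' Y f g (ζ : Ext1 (G Y) X)
    obtain ⟨g, rfl⟩ := injClass_surjective g
    have h1 : e X Y (injClass f ≫ injClass g) ζ =
        e X' Y (injClass g) (ζ ≫ f.hom⟦(1 : ℤ)⟧') := by
      rw [← Functor.map_comp, he, he, leftPairing_apply, leftPairing_apply,
        FullSubcategory.comp_hom, Functor.map_comp, Category.assoc]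
    exact h1
  · intro X Y Y' g h (ζ : Ext1 (G Y') X)
    obtain ⟨g, rfl⟩ := injClass_surjective g
    have h1 : e X Y' (injClass g ≫ injClass h) ζ =
        θ Y' ((ζ ≫ g.hom⟦(1 : ℤ)⟧') ≫ h.hom⟦(1 : ℤ)⟧') := by
      rw [← Functor.map_comp, he, leftPairing_apply, FullSubcategory.comp_hom, Functor.map_comp,
        Category.assoc]
    have h2 : e X Y (injClass g) ((leftMap hE hθ h).hom ≫ ζ) =
        θ Y' ((ζ ≫ g.hom⟦(1 : ℤ)⟧') ≫ h.hom⟦(1 : ℤ)⟧') := by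
      rw [he, leftPairing_apply, leftMap_spec hE hθ h (ζ ≫ g.hom⟦(1 : ℤ)⟧'), Category.assoc]
    exact h1.trans h2.symm

include hE in
theorem nonempty_leftARFunctor_iff :
    Nonempty (LeftARFunctor R C) ↔ ∀ X : C.FullSubcategory, HasLeftDual R X := by
  refine ⟨fun ⟨F⟩ X => ⟨_, _, F.isLeftDual X⟩, fun h => ?_⟩
  choose G θ hθ using h
  obtain ⟨F, -⟩ := exists_leftARFunctor hE hθ
  exact ⟨F⟩

/-! ### Left Serre functors -/

/-- In a left triangulated subcategory `Ext¹(Z, X)` is the module of projectively stable morphisms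
from `Z[-1]` to `X`. -/
noncomputable def extProjEquiv (Z X : C.FullSubcategory) :
    Ext1 Z X ≃ₗ[R] (toProj (desusp Z) ⟶ toProj X) :=
  (desuspEquiv R Z X).symm ≪≫ₗ projClassEquiv R (desusp Z) X

theorem extProjEquiv_symm_projClass {Z X : C.FullSubcategory} (k : desusp Z ⟶ X) :
    (extProjEquiv (R := R) Z X).symm (projClass k) =
      (desuspIso Z).inv ≫ k.hom⟦(1 : ℤ)⟧' := by
  rw [LinearEquiv.symm_apply_eq, ← desuspEquiv_apply R k, extProjEquiv, LinearEquiv.trans_apply,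
    LinearEquiv.symm_apply_apply]
  rfl

/-- The inverse shift of a left Auslander-Reiten functor is a left Serre functor. -/
theorem LeftARFunctor.exists_leftSerreFunctor (F : LeftARFunctor R C) :
    ∃ S : LeftSerreFunctor R C, S.S = F.τ ⋙ projShift C := by
  have := F.additive
  refine ⟨⟨F.τ ⋙ projShift C, inferInstance, fun X Y => F.iso X Y ≪≫ₗ
    LinearEquiv.arrowCongr (extProjEquiv (F.τ.obj (toInj Y)).as X) (LinearEquiv.refl R _),
    ?_, ?_⟩, rfl⟩
  · intro X X' Y f g u
    obtain ⟨u, rfl⟩ := projClass_surjective (X := desusp (F.τ.obj (toInj Y)).as) u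
    change F.iso X Y (injClass f ≫ g) ((extProjEquiv _ _).symm (projClass u)) =
      F.iso X' Y g ((extProjEquiv _ _).symm _)
    have h1 : projClass u ≫ projClass f = projClass (u ≫ f) := (Functor.map_comp _ u f).symm
    refine (congrArg _ (extProjEquiv_symm_projClass u)).trans
      ((F.naturality_left f g _).trans (congrArg _ ?_))
    refine Eq.trans ?_ ((congrArg _ h1).trans (extProjEquiv_symm_projClass (u ≫ f))).symm
    rw [Category.assoc, ← Functor.map_comp, FullSubcategory.comp_hom]
  · intro X Y Y' g h u
    obtain ⟨u, rfl⟩ := projClass_surjective (X := desusp (F.τ.obj (toInj Y')).as) u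
    obtain ⟨t, ht⟩ := projClass_surjective (X := (F.τ.obj (toInj Y)).as)
      (Y := (F.τ.obj (toInj Y')).as) (F.τ.map (injClass h))
    have h1 : (F.τ ⋙ projShift C).map (injClass h) ≫ projClass u =
        projClass (desuspMap t ≫ u) := by
      refine Eq.trans ?_ (Functor.map_comp (Quotient.functor (projRel C)) (desuspMap t) u).symm
      rw [Functor.comp_map, ← ht]
      rfl
    change F.iso X Y' (g ≫ injClass h) ((extProjEquiv _ _).symm (projClass u)) =
      F.iso X Y g ((extProjEquiv _ _).symm _)
    have h2 := F.naturality_right g h ((desuspIso (F.τ.obj (toInj Y')).as).inv ≫ u.hom⟦(1 : ℤ)⟧')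
    rw [← ht] at h2
    refine (congrArg _ (extProjEquiv_symm_projClass u)).trans (h2.trans (congrArg _ ?_))
    refine Eq.trans ?_
      ((congrArg _ h1).trans (extProjEquiv_symm_projClass (desuspMap t ≫ u))).symm
    change t.hom ≫ _ ≫ _ = _
    rw [FullSubcategory.comp_hom, Functor.map_comp, ← Category.assoc, ← Category.assoc]
    congr 1
    rw [Iso.comp_inv_eq, Category.assoc, Iso.eq_inv_comp]
    exact (desuspIso_naturality t).symm

/-- If `Z[-1]` is isomorphic to the value of a left Serre functor at `X`, then `Z` and `X` form a
left dual pair. -/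
theorem LeftSerreFunctor.exists_isLeftDual (F : LeftSerreFunctor R C) {Z X : C.FullSubcategory}
    (e : desusp Z ≅ (F.S.obj (toInj X)).as) : ∃ θ : IDual R (Ext1 Z X), IsLeftDual θ := by
  let s : ∀ W : C.FullSubcategory, Ext1 Z W ≃ₗ[R] (F.S.obj (toInj X) ⟶ toProj W) := fun W =>
    extProjEquiv Z W ≪≫ₗ LinearEquiv.ofLinearMap
      (Linear.leftComp R _ (projClass e.inv)) (Linear.leftComp R _ (projClass e.hom))
      (by ext f
          change projClass e.inv ≫ projClass e.hom ≫ f = f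
          rw [← Category.assoc, ← Functor.map_comp, Iso.inv_hom_id, CategoryTheory.Functor.map_id]
          exact Category.id_comp _)
      (by ext f
          change projClass e.hom ≫ projClass e.inv ≫ f = f
          rw [← Category.assoc, ← Functor.map_comp, Iso.hom_inv_id, CategoryTheory.Functor.map_id]
          exact Category.id_comp _)
  have hs : ∀ {W W' : C.FullSubcategory} (f : W ⟶ W') (ζ : Ext1 Z W),
      s W' (ζ ≫ f.hom⟦(1 : ℤ)⟧') = s W ζ ≫ projClass f := fun {W W'} f ζ => by
    obtain ⟨k, rfl⟩ := (desuspEquiv R Z W).surjective ζ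
    have h1 : desuspEquiv R Z W k ≫ f.hom⟦(1 : ℤ)⟧' = desuspEquiv R Z W' (k ≫ f) := by
      rw [desuspEquiv_apply, desuspEquiv_apply, FullSubcategory.comp_hom, Functor.map_comp,
        Category.assoc]
    have h2 : ∀ {V : C.FullSubcategory} (k : desusp Z ⟶ V),
        s V (desuspEquiv R Z V k) = projClass e.inv ≫ projClass k := fun {V} k => by
      change projClass e.inv ≫ projClass ((desuspEquiv R Z V).symm (desuspEquiv R Z V k)) = _
      rw [LinearEquiv.symm_apply_apply]
    rw [h1, h2, h2, Category.assoc]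
    exact congrArg _ (Functor.map_comp _ k f)
  have key : ∀ {W : C.FullSubcategory} (f : W ⟶ X),
      leftPairing (F.iso X X (𝟙 _) ∘ₗ (s X).toLinearMap) W f =
        F.iso W X (injClass f) ∘ₗ (s W).toLinearMap := fun {W} f => LinearMap.ext fun ζ => by
    have h := F.naturality_left f (𝟙 (toInj X)) (s W ζ)
    rw [Category.comp_id, ← hs] at h
    exact h.symm
  refine ⟨F.iso X X (𝟙 _) ∘ₗ (s X).toLinearMap, fun {W} f hf => ?_, fun W l => ?_⟩
  · have h0 : F.iso W X (injClass f) = 0 := LinearMap.ext fun u => by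
      have h := LinearMap.congr_fun hf ((s W).symm u)
      rw [key] at h
      simpa using h
    rw [LinearEquiv.map_eq_zero_iff] at h0
    have := (injClass_eq_iff f 0).1 (h0.trans (Functor.map_zero _ _ _).symm)
    rwa [sub_zero] at this
  · obtain ⟨f, hf⟩ := injClass_surjective ((F.iso W X).symm (l ∘ₗ (s W).symm.toLinearMap))
    refine ⟨f, ?_⟩
    rw [key, hf, LinearEquiv.apply_symm_apply]
    ext ζ
    simp

end Left

end TriExact

namespace TriExact

open Pretriangulated ObjectProperty Limits ZeroObject

/-! ### Auslander-Reiten and Serre equivalences -/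

section Equivalences

variable {R : Type u} [CommRing R] {A : Type w} [Category.{v} A] [Preadditive A] [Linear R A]
  [HasShift A ℤ] [∀ n : ℤ, (shiftFunctor A n).Additive] [∀ n : ℤ, (shiftFunctor A n).Linear R]
  {C : ObjectProperty A} [HasZeroObject A] [Pretriangulated A] [C.ContainsZero]
  [C.IsClosedUnderIsomorphisms]

/-- The desuspension of the values of a right Serre functor with image in `C[1]` yields right dual
pairs. -/
theorem RightSerreFunctor.hasRightDual [C.IsTriangulatedClosed₃] (F : RightSerreFunctor R C)
    (hF : ∀ X : ProjStable C, C ((F.S.obj X).as.obj⟦(-1 : ℤ)⟧)) (Z : C.FullSubcategory) :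
    HasRightDual R Z := by
  obtain ⟨θ, hθ⟩ := F.exists_isRightDual (Z := Z) (X := ⟨_, hF (toProj Z)⟩)
    (C.isoMk ((shiftFunctorCompIsoId A (-1 : ℤ) 1 (by simp)).app (F.S.obj (toProj Z)).as.obj))
  exact ⟨_, θ, hθ⟩

/-- The suspension of the values of a left Serre functor with image in `C[-1]` yields left dual
pairs. -/
theorem LeftSerreFunctor.hasLeftDual [C.IsTriangulatedClosed₁] (F : LeftSerreFunctor R C)
    (hF : ∀ X : InjStable C, C ((F.S.obj X).as.obj⟦(1 : ℤ)⟧)) (X : C.FullSubcategory) :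
    HasLeftDual R X := by
  obtain ⟨θ, hθ⟩ := F.exists_isLeftDual (X := X) (Z := ⟨_, hF (toInj X)⟩)
    (C.isoMk ((shiftFunctorCompIsoId A (1 : ℤ) (-1) (by simp)).app (F.S.obj (toInj X)).as.obj))
  exact ⟨_, θ, hθ⟩

/-- If the right Auslander-Reiten functor `τ` is essentially surjective, each `X ≅ τ Z` is the
second member of a right dual pair, which is also a left dual pair. -/
theorem RightARFunctor.hasLeftDual [C.IsTriangulatedClosed₃]
    (hE : ∀ X Y : C.FullSubcategory, IsIReflexive R (Ext1 X Y)) (F : RightARFunctor R C)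
    (hF : F.τ.IsEquivalence) (X : C.FullSubcategory) : HasLeftDual R X := by
  obtain ⟨e⟩ := nonempty_iso_of_injStable (F.τ.objObjPreimageIso (toInj X))
  exact HasLeftDual.of_iso ⟨_, _, (F.isRightDual (F.τ.objPreimage (toInj X)).as).isLeftDual hE⟩ e

theorem LeftARFunctor.hasRightDual [C.IsTriangulatedClosed₁]
    (hE : ∀ X Y : C.FullSubcategory, IsIReflexive R (Ext1 X Y)) (F : LeftARFunctor R C)
    (hF : F.τ.IsEquivalence) (Z : C.FullSubcategory) : HasRightDual R Z := by
  obtain ⟨e⟩ := nonempty_iso_of_projStable (F.τ.objObjPreimageIso (toProj Z))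
  exact HasRightDual.of_iso
    ⟨_, _, (F.isLeftDual (F.τ.objPreimage (toProj Z)).as).isRightDual hE⟩ e.symm

/-- An essentially surjective right Serre functor takes the value `X[1]` at some `Z`, up to
isomorphism, and then `Z` is a left dual of `X`. -/
theorem RightSerreFunctor.hasLeftDual [C.IsTriangulatedClosed₃]
    (hE : ∀ X Y : C.FullSubcategory, IsIReflexive R (Ext1 X Y)) (F : RightSerreFunctor R C)
    (hF : F.S.IsEquivalence) (X : C.FullSubcategory) : HasLeftDual R X := by
  obtain ⟨e⟩ := nonempty_iso_of_injStable (F.S.objObjPreimageIso (toInj (susp X)))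
  obtain ⟨θ, hθ⟩ := F.exists_isRightDual e.symm
  exact ⟨_, θ, hθ.isLeftDual hE⟩

theorem LeftSerreFunctor.hasRightDual [C.IsTriangulatedClosed₁]
    (hE : ∀ X Y : C.FullSubcategory, IsIReflexive R (Ext1 X Y)) (F : LeftSerreFunctor R C)
    (hF : F.S.IsEquivalence) (Z : C.FullSubcategory) : HasRightDual R Z := by
  obtain ⟨e⟩ := nonempty_iso_of_projStable (F.S.objObjPreimageIso (toProj (desusp Z)))
  obtain ⟨θ, hθ⟩ := F.exists_isLeftDual e.symm
  exact ⟨_, θ, hθ.isRightDual hE⟩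

variable [C.IsTriangulatedClosed₁] [C.IsTriangulatedClosed₃]
  (hE : ∀ X Y : C.FullSubcategory, IsIReflexive R (Ext1 X Y))
include hE

/-- If all objects belong to dual pairs on either side, the right Auslander-Reiten functor is
essentially surjective: `X` has a left dual `Z`, and then `X` is the right dual of `Z`. -/
theorem exists_rightARFunctor_isEquivalence (hr : ∀ Z : C.FullSubcategory, HasRightDual R Z)
    (hl : ∀ X : C.FullSubcategory, HasLeftDual R X) :
    ∃ F : RightARFunctor R C, F.τ.IsEquivalence := by
  choose G θ hθ using hr
  obtain ⟨F, hF⟩ := exists_rightARFunctor hE hθ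
  refine ⟨F, ?_⟩
  rw [hF]
  exact
    { essSurj := ⟨fun X => by
        obtain ⟨Z, η, hη⟩ := hl X.as
        obtain ⟨e⟩ := (hθ Z).nonempty_iso hE (hη.isRightDual hE)
        exact ⟨toProj Z, ⟨(Quotient.functor (injRel C)).mapIso e⟩⟩⟩ }

theorem exists_leftARFunctor_isEquivalence (hr : ∀ Z : C.FullSubcategory, HasRightDual R Z)
    (hl : ∀ X : C.FullSubcategory, HasLeftDual R X) :
    ∃ F : LeftARFunctor R C, F.τ.IsEquivalence := by
  choose G θ hθ using hl
  obtain ⟨F, hF⟩ := exists_leftARFunctor hE hθ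
  refine ⟨F, ?_⟩
  rw [hF]
  exact
    { essSurj := ⟨fun Z => by
        obtain ⟨X, η, hη⟩ := hr Z.as
        obtain ⟨e⟩ := (hθ X).nonempty_iso hE (hη.isLeftDual hE)
        exact ⟨toInj X, ⟨(Quotient.functor (projRel C)).mapIso e⟩⟩⟩ }

end Equivalences

end TriExact

theorem mainTheorem6 {R : Type u} [CommRing R]
    {A : Type w} [Category.{v} A] [Preadditive A] [Limits.HasZeroObject A] [HasShift A ℤ]
    [∀ n : ℤ, (shiftFunctor A n).Additive] [Pretriangulated A] [IsTriangulated A]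
    [Linear R A] [∀ n : ℤ, (shiftFunctor A n).Linear R]
    (C : ObjectProperty A) [C.ContainsZero] [C.IsClosedUnderIsomorphisms] [C.IsTriangulatedClosed₂]
    (hKS : IsKrullSchmidt C.FullSubcategory) (hC : TriExact.HomReflexive R C) :
    (C.IsTriangulatedClosed₃ →
      List.TFAE
        [TriExact.HasAlmostSplitSequencesOnRight C,
         Nonempty (TriExact.RightARFunctor R C),
         ∃ F : TriExact.RightSerreFunctor R C,
           ∀ X : TriExact.ProjStable C, C ((F.S.obj X).as.obj⟦(-1 : ℤ)⟧)]) ∧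
    (C.IsTriangulatedClosed₁ →
      List.TFAE
        [TriExact.HasAlmostSplitSequencesOnLeft C,
         Nonempty (TriExact.LeftARFunctor R C),
         ∃ F : TriExact.LeftSerreFunctor R C,
           ∀ X : TriExact.InjStable C, C ((F.S.obj X).as.obj⟦(1 : ℤ)⟧)]) ∧
    (C.IsTriangulatedClosed₁ → C.IsTriangulatedClosed₃ →
      List.TFAE
        [TriExact.HasAlmostSplitSequences C,
         ∃ F : TriExact.RightARFunctor R C, F.τ.IsEquivalence,
         ∃ F : TriExact.LeftARFunctor R C, F.τ.IsEquivalence,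
         ∃ F : TriExact.RightSerreFunctor R C, F.S.IsEquivalence,
         ∃ F : TriExact.LeftSerreFunctor R C, F.S.IsEquivalence]) := by
  open TriExact in
  refine ⟨fun _ => ?_, fun _ => ?_, fun _ _ => ?_⟩
  · have hE := hC.ext_of_right
    tfae_have 1 ↔ 2 :=
      (hasAlmostSplitSequencesOnRight_iff hE hKS).trans (nonempty_rightARFunctor_iff hE).symm
    tfae_have 2 → 3 := fun ⟨F⟩ => by
      obtain ⟨S, hS⟩ := F.exists_rightSerreFunctor
      refine ⟨S, fun X => ?_⟩
      rw [hS]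
      exact C.prop_of_iso ((shiftFunctorCompIsoId A (1 : ℤ) (-1) (by simp)).app _).symm
        (F.τ.obj X).as.property
    tfae_have 3 → 2 := fun ⟨F, hF⟩ => (nonempty_rightARFunctor_iff hE).2 (F.hasRightDual hF)
    tfae_finish
  · have hE := hC.ext_of_left
    tfae_have 1 ↔ 2 :=
      (hasAlmostSplitSequencesOnLeft_iff hE hKS).trans (nonempty_leftARFunctor_iff hE).symm
    tfae_have 2 → 3 := fun ⟨F⟩ => by
      obtain ⟨S, hS⟩ := F.exists_leftSerreFunctor
      refine ⟨S, fun X => ?_⟩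
      rw [hS]
      exact C.prop_of_iso ((shiftFunctorCompIsoId A (-1 : ℤ) 1 (by simp)).app _).symm
        (F.τ.obj X).as.property
    tfae_have 3 → 2 := fun ⟨F, hF⟩ => (nonempty_leftARFunctor_iff hE).2 (F.hasLeftDual hF)
    tfae_finish
  · have hE := hC.ext_of_right
    have h1 : HasAlmostSplitSequences C ↔ (∀ Z : C.FullSubcategory, HasRightDual R Z) ∧
        ∀ X : C.FullSubcategory, HasLeftDual R X :=
      and_congr (hasAlmostSplitSequencesOnRight_iff hE hKS)
        (hasAlmostSplitSequencesOnLeft_iff hE hKS)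
    tfae_have 1 → 2 := fun h =>
      exists_rightARFunctor_isEquivalence hE (h1.1 h).1 (h1.1 h).2
    tfae_have 1 → 3 := fun h =>
      exists_leftARFunctor_isEquivalence hE (h1.1 h).1 (h1.1 h).2
    tfae_have 2 → 1 := fun ⟨F, hF⟩ =>
      h1.2 ⟨fun Z => ⟨_, _, F.isRightDual Z⟩, F.hasLeftDual hE hF⟩
    tfae_have 3 → 1 := fun ⟨F, hF⟩ =>
      h1.2 ⟨F.hasRightDual hE hF, fun X => ⟨_, _, F.isLeftDual X⟩⟩
    tfae_have 2 → 4 := fun ⟨F, hF⟩ => by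
      obtain ⟨S, hS⟩ := F.exists_rightSerreFunctor
      exact ⟨S, by rw [hS]; infer_instance⟩
    tfae_have 3 → 5 := fun ⟨F, hF⟩ => by
      obtain ⟨S, hS⟩ := F.exists_leftSerreFunctor
      exact ⟨S, by rw [hS]; infer_instance⟩
    tfae_have 4 → 1 := fun ⟨F, hF⟩ =>
      h1.2 ⟨F.hasRightDual fun X => prop_shift_neg_one (F.S.obj X).as.property,
        F.hasLeftDual hE hF⟩
    tfae_have 5 → 1 := fun ⟨F, hF⟩ =>
      h1.2 ⟨F.hasRightDual hE hF,
        F.hasLeftDual fun X => prop_shift_one (F.S.obj X).as.property⟩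
    tfae_finish
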